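/- Let $\Gamma$ be a finite simplicial graph that is chordal: every cycle of length at least four has a chord, i.e. an edge of $\Gamma$ joining two vertices of the cycle that are not adjacent along it. Let $A_\Gamma$ be the right-angled Artin group of $\Gamma$, generated by the vertices of $\Gamma$ subject to the relations that adjacent vertices commute. Let $f\colon A_\Gamma\to\mathbb R$ be a discrete character, i.e. a homomorphism whose image is infinite cyclic. Then exactly one of the following holds. 1. (wild) $\ker f$ surjects onto $\mathbb F_\infty$, the free group of countably infinite rank. 2. (tame) $\ker f$ splits as a finite graph of groups whose vertex and edge groups are finitely generated free abelian, i.e. it is isomorphic to the fundamental group of a finite connected graph of groups of this kind (it is a vGBS group). Moreover, in the tame case the graph of groups $\widehat{\mathcal G}$ can be obtained by iterated splittings along minimal separators that are cliques, in the following sense. For a full subgraph $\Lambda\subseteq\Gamma$ let $f_\Lambda$ be the restriction of $f$ to $A_\Lambda$ and $I_\Lambda=[f(A_\Gamma):f(A_\Lambda)]$. A splitting of a graph $\Lambda$ is a pair of full subgraphs $\Lambda_1,\Lambda_2$ with $\Lambda=\Lambda_1\cup\Lambda_2$ (on vertices and on edges) such that $\Lambda_1$, $\Lambda_2$ and $\Lambda_3=\Lambda_1\cap\Lambda_2$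 are nonempty and pairwise distinct. Starting from $\Gamma$ one repeatedly splits pieces $\Lambda$ in such a way that $\Lambda_3$ is a clique and is minimal among the full subgraphs of $\Lambda$ whose removal disconnects $\Lambda$, until all the pieces are cliques. The vertices and edges of $\widehat{\mathcal G}$ are distributed accordingly: each terminal clique $C$ contributes exactly $I_C<\infty$ vertices, with groups isomorphic to $\ker f_C$, and each splitting $(\Lambda_1,\Lambda_2,\Lambda_3)$ that is used contributes exactly $I_{\Lambda_3}<\infty$ edges, with groups isomorphic to $\ker f_{\Lambda_3}$, each joining a vertex that comes from $\Lambda_1$ to a vertex that comes from $\Lambda_2$. -/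

import Mathlib

namespace ArtinKernel

/-- A simple graph is chordal if every cycle of length at least four has a chord, i.e. an edge of
the graph joining two vertices of the cycle that are not adjacent along the cycle. -/
def IsChordal {V : Type*} (Γ : SimpleGraph V) : Prop :=
  ∀ (u : V) (c : Γ.Walk u u), c.IsCycle → 4 ≤ c.length →
    ∃ x ∈ c.support, ∃ y ∈ c.support, Γ.Adj x y ∧ s(x, y) ∉ c.edges

/-! ### Right-angled Artin groups and their characters -/

/-- The defining relators `x y x⁻¹ y⁻¹`, one for each pair of adjacent vertices. -/
def raagRels {V : Type*} (Γ : SimpleGraph V) : Set (FreeGroup V) :=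
  {r | ∃ x y : V, Γ.Adj x y ∧
    r = FreeGroup.of x * FreeGroup.of y * (FreeGroup.of x)⁻¹ * (FreeGroup.of y)⁻¹}

/-- The right-angled Artin group of `Γ`: one generator for each vertex, and two generators commute
when the vertices are adjacent. -/
abbrev RAAG {V : Type*} (Γ : SimpleGraph V) : Type _ := PresentedGroup (raagRels Γ)

/-- The natural homomorphism from the right-angled Artin group of the full subgraph on `S`. -/
def RAAG.inclusion {V : Type*} (Γ : SimpleGraph V) (S : Set V) :
    RAAG (Γ.induce S) →* RAAG Γ :=
  PresentedGroup.toGroup (f := fun v : S => (PresentedGroup.of (v : V) : RAAG Γ)) (by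
    rintro r ⟨x, y, hxy, rfl⟩
    have h : PresentedGroup.mk (raagRels Γ) (FreeGroup.of (x : V) * FreeGroup.of (y : V) *
        (FreeGroup.of (x : V))⁻¹ * (FreeGroup.of (y : V))⁻¹) = 1 :=
      PresentedGroup.one_of_mem ⟨x, y, hxy, rfl⟩
    simpa [PresentedGroup.of] using h)

/-- A character (homomorphism to the additive group of the reals) is discrete if its image is an
infinite cyclic subgroup. -/
def IsDiscreteCharacter {G : Type*} [Group G] (f : G →* Multiplicative ℝ) : Prop :=
  IsCyclic f.range ∧ Infinite f.range

/-- The restriction of a character to the right-angled Artin group of a full subgraph. -/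
def restrict {V : Type*} {Γ : SimpleGraph V} (f : RAAG Γ →* Multiplicative ℝ) (S : Set V) :
    RAAG (Γ.induce S) →* Multiplicative ℝ :=
  f.comp (RAAG.inclusion Γ S)

/-- The index of `f(A_S)` in `f(A_Γ)` (it is `0` when the index is infinite). -/
noncomputable def imageIndex {V : Type*} {Γ : SimpleGraph V} (f : RAAG Γ →* Multiplicative ℝ)
    (S : Set V) : ℕ :=
  (restrict f S).range.relIndex f.range

/-! ### Graphs of groups and their fundamental groups -/

/-- A graph of groups. The underlying graph may have loops and multiple edges; each geometric edge
is listed once, with a chosen orientation. -/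
structure GraphOfGroups.{u} where
  Vert : Type u
  Edge : Type u
  src : Edge → Vert
  tgt : Edge → Vert
  VGroup : Vert → Type u
  EGroup : Edge → Type u
  [vgroup : ∀ v, Group (VGroup v)]
  [egroup : ∀ e, Group (EGroup e)]
  srcMap : ∀ e, EGroup e →* VGroup (src e)
  tgtMap : ∀ e, EGroup e →* VGroup (tgt e)
  srcMap_injective : ∀ e, Function.Injective (srcMap e)
  tgtMap_injective : ∀ e, Function.Injective (tgtMap e)

attribute [instance] GraphOfGroups.vgroup GraphOfGroups.egroup

namespace GraphOfGroups

/-- A set `T` of edges is a spanning tree: it has no loops, no two of its edges have the same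
endpoints, and the simple graph that it forms on all the vertices is a tree. A graph has a spanning
tree exactly when it is connected and nonempty. -/
def IsSpanningTree (𝒢 : GraphOfGroups) (T : Set 𝒢.Edge) : Prop :=
  (∀ e ∈ T, 𝒢.src e ≠ 𝒢.tgt e) ∧
  Set.InjOn (fun e => s(𝒢.src e, 𝒢.tgt e)) T ∧
  (SimpleGraph.fromEdgeSet ((fun e => s(𝒢.src e, 𝒢.tgt e)) '' T)).IsTree

/-- The free product of all vertex groups and of the free group on the edges. -/
abbrev BigProduct (𝒢 : GraphOfGroups) : Type _ :=
  Monoid.Coprod (Monoid.CoprodI 𝒢.VGroup) (FreeGroup 𝒢.Edge)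

/-- An element of a vertex group, in the free product. -/
def vert (𝒢 : GraphOfGroups) (v : 𝒢.Vert) : 𝒢.VGroup v →* 𝒢.BigProduct :=
  Monoid.Coprod.inl.comp Monoid.CoprodI.of

/-- The letter of an edge, in the free product. -/
def letter (𝒢 : GraphOfGroups) (e : 𝒢.Edge) : 𝒢.BigProduct :=
  Monoid.Coprod.inr (FreeGroup.of e)

/-- The relators `t_e · tgt(a) · t_e⁻¹ · src(a)⁻¹` for each edge `e` and each `a` in its group, and
`t_e` for each edge `e` of `T`. -/
def relators (𝒢 : GraphOfGroups) (T : Set 𝒢.Edge) : Set 𝒢.BigProduct :=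
  {r | ∃ (e : 𝒢.Edge) (a : 𝒢.EGroup e),
      r = 𝒢.letter e * 𝒢.vert _ (𝒢.tgtMap e a) * (𝒢.letter e)⁻¹ *
        (𝒢.vert _ (𝒢.srcMap e a))⁻¹} ∪
  {r | ∃ e ∈ T, r = 𝒢.letter e}

/-- The fundamental group of a graph of groups with respect to a spanning tree `T` (it does not
depend on `T` up to isomorphism). -/
abbrev FundamentalGroup (𝒢 : GraphOfGroups) (T : Set 𝒢.Edge) : Type _ :=
  𝒢.BigProduct ⧸ Subgroup.normalClosure (𝒢.relators T)

end GraphOfGroups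

/-- `G` splits as the graph of groups `𝒢`: the underlying graph is connected and `G` is isomorphic
to the fundamental group. -/
def SplitsAs.{u} (G : Type u) [Group G] (𝒢 : GraphOfGroups.{u}) : Prop :=
  ∃ T : Set 𝒢.Edge, 𝒢.IsSpanningTree T ∧ Nonempty (G ≃* 𝒢.FundamentalGroup T)

/-- Finitely generated free abelian groups (the trivial group is the case `n = 0`). -/
def IsFGFreeAbelian (G : Type*) [Group G] : Prop :=
  ∃ n : ℕ, Nonempty (G ≃* Multiplicative (Fin n → ℤ))

/-- A finite graph of groups whose vertex and edge groups are finitely generated free abelian. -/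
def IsFiniteFreeAbelian (𝒢 : GraphOfGroups) : Prop :=
  Finite 𝒢.Vert ∧ Finite 𝒢.Edge ∧
  (∀ v, IsFGFreeAbelian (𝒢.VGroup v)) ∧ (∀ e, IsFGFreeAbelian (𝒢.EGroup e))

/-- Tame groups, i.e. generalized Baumslag-Solitar groups of variable rank. -/
def IsVGBS.{u} (G : Type u) [Group G] : Prop :=
  ∃ 𝒢 : GraphOfGroups.{u}, IsFiniteFreeAbelian 𝒢 ∧ SplitsAs G 𝒢

/-- Wild groups: those that surject onto the free group of countably infinite rank. -/
def IsWild (G : Type*) [Group G] : Prop :=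
  ∃ φ : G →* FreeGroup ℕ, Function.Surjective φ

/-! ### Iterated splittings along minimal separators that are cliques -/

/-- The full subgraphs on `A`, `B` and `A ∩ B` form a splitting of the full subgraph on `C`: they
are nonempty and pairwise distinct, and both the vertices and the edges of the subgraph on `C` are
those of the subgraphs on `A` and on `B`. -/
def IsSplitting {V : Type*} (Γ : SimpleGraph V) (C A B : Set V) : Prop :=
  A ∪ B = C ∧ (A ∩ B).Nonempty ∧ A ≠ B ∧ A ≠ A ∩ B ∧ B ≠ A ∩ B ∧
  ∀ x ∈ C, ∀ y ∈ C, Γ.Adj x y → (x ∈ A ∧ y ∈ A) ∨ (x ∈ B ∧ y ∈ B)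

/-- `S` separates the full subgraph on `C`: removing `S` leaves a disconnected graph (the empty
graph does not count as disconnected). -/
def IsSeparating {V : Type*} (Γ : SimpleGraph V) (C S : Set V) : Prop :=
  S ⊆ C ∧ ¬ (Γ.induce (C \ S)).Preconnected

/-- The part of the graph of groups `𝒢` with vertex set `P` and edge set `Q` comes from the full
subgraph on `C` by splitting it along minimal separators that are cliques, then splitting the two
pieces in the same way, and so on until all pieces are cliques.

A terminal clique `C` contributes `[f(A_Γ) : f(A_C)]` vertices, with groups isomorphic to the kernel
of `f` on `A_C`. A splitting of `C` into `A` and `B` contributes `[f(A_Γ) : f(A_{A ∩ B})]` edges, with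
groups isomorphic to the kernel of `f` on `A_{A ∩ B}`; they join the part of `A` to the part of `B`.
All these indices are finite. -/
inductive IsIteratedCliqueSplitting {V : Type*} {Γ : SimpleGraph V}
    (f : RAAG Γ →* Multiplicative ℝ) (𝒢 : GraphOfGroups) :
    Set V → Set 𝒢.Vert → Set 𝒢.Edge → Prop
  | clique (C : Set V) (P : Set 𝒢.Vert)
      (hclique : Γ.IsClique C)
      (hindex : imageIndex f C ≠ 0)
      (hcard : P.ncard = imageIndex f C)
      (hgroup : ∀ v ∈ P, Nonempty (𝒢.VGroup v ≃* (restrict f C).ker)) :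
      IsIteratedCliqueSplitting f 𝒢 C P ∅
  | split (C A B : Set V) (PA PB : Set 𝒢.Vert) (QA QB Q : Set 𝒢.Edge)
      (hsplit : IsSplitting Γ C A B)
      (hminimal : Minimal (IsSeparating Γ C) (A ∩ B))
      (hclique : Γ.IsClique (A ∩ B))
      (hA : IsIteratedCliqueSplitting f 𝒢 A PA QA)
      (hB : IsIteratedCliqueSplitting f 𝒢 B PB QB)
      (hP : Disjoint PA PB)
      (hQ : Disjoint QA QB) (hQA : Disjoint Q QA) (hQB : Disjoint Q QB)
      (hindex : imageIndex f (A ∩ B) ≠ 0)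
      (hcard : Q.ncard = imageIndex f (A ∩ B))
      (hgroup : ∀ e ∈ Q, Nonempty (𝒢.EGroup e ≃* (restrict f (A ∩ B)).ker))
      (hends : ∀ e ∈ Q, 𝒢.src e ∈ PA ∧ 𝒢.tgt e ∈ PB) :
      IsIteratedCliqueSplitting f 𝒢 C (PA ∪ PB) (QA ∪ QB ∪ Q)

end ArtinKernel

/-!
# Kernels of discrete characters of chordal right-angled Artin groups

Let `q : A_Γ → ℤ` be the character `f`, rescaled to be surjective.

Suppose that `q` vanishes on a set `S` of vertices whose removal disconnects `Γ` (possibly `S = ∅`).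
Killing `S` leaves a free product of two nontrivial right-angled Artin groups. This maps over `ℤ` to
`FreeGroup ℤ ⋊ ℤ`, by sending the factors to the complement `ℤ` and to a conjugate of it, or to
a free generator, and the kernel then surjects onto a free group of infinite rank
(`isWild_ker_of_isSeparating`).

Otherwise `q` is nontrivial on every separating set. By Dirac's theorem a minimal separator of
a chordal graph is a clique (`isClique_of_minimal_isSeparating`), so `Γ` can be split repeatedly until
all pieces are cliques. This presents `A_Γ` as a tree of free abelian groups. The kernel is the
fundamental group of the covering graph of groups, whose vertices and edges above a clique `C`
correspond to the cosets of `q(A_C)` in `ℤ`; they are finite in number since `q` is nontrivial on all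
the cliques that occur. In place of Bass-Serre theory, the proof works with cocycles, that is, functors
from the action groupoid of `A_Γ` on `ℤ` to groups. By induction over the splittings, every
representation of the covering graph of groups extends to a cocycle
(`SubgroupGraph.hasExtension_join`), and from this the isomorphism is deduced
(`SubgroupGraph.splitsAs_cover`).

The two cases exclude each other, because the fundamental group of a finite graph of finitely generated
groups is finitely generated and a free group of infinite rank is not (`IsVGBS.not_isWild`).
-/

namespace ArtinKernel
universe u

/-! ### Cocycles over an action on an abelian quotient -/

section Cocycles

variable {G Q H : Type*} [Group G] [CommGroup Q] [Group H]

/-- The group `G` acts on the abelian group `Q` by `g • n = q g * n`. A cocycle on `M ≤ G` with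
values in `H` is a functor to `H` from the action groupoid of `M` on `Q`: the value `F g n` belongs to
the arrow `n ⟶ q g * n` given by `g`. Nothing is required of `F g` for `g ∉ M`. -/
def IsCocycleOn (q : G →* Q) (M : Subgroup G) (F : G → Q → H) : Prop :=
  ∀ g ∈ M, ∀ g' ∈ M, ∀ n, F (g * g') n = F g (q g' * n) * F g' n

namespace IsCocycleOn

variable {q : G →* Q} {M : Subgroup G} {F : G → Q → H}

theorem mono {N : Subgroup G} (hF : IsCocycleOn q M F) (h : N ≤ M) : IsCocycleOn q N F :=
  fun g hg g' hg' n => hF g (h hg) g' (h hg') n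

theorem map_one (hF : IsCocycleOn q M F) (n : Q) : F 1 n = 1 := by
  have := hF 1 M.one_mem 1 M.one_mem n
  simpa using this

theorem map_inv (hF : IsCocycleOn q M F) {g : G} (hg : g ∈ M) (n : Q) :
    F g⁻¹ n = (F g (q g⁻¹ * n))⁻¹ := by
  have := hF g hg g⁻¹ (M.inv_mem hg) n
  rw [mul_inv_cancel, hF.map_one] at this
  exact eq_inv_of_mul_eq_one_right this.symm

end IsCocycleOn

theorem exists_move (q : G →* Q) (M : Subgroup G) (n : Q) :
    ∃ g ∈ M, q g * (n : Q ⧸ M.map q).out = n := by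
  obtain ⟨h, hh⟩ := QuotientGroup.mk_out_eq_mul (M.map q) n
  obtain ⟨g, hg, hgh⟩ := h.2
  refine ⟨g⁻¹, M.inv_mem hg, ?_⟩
  rw [hh, ← hgh, _root_.map_inv]
  rw [mul_comm n, inv_mul_cancel_left]

/-- A chosen element of `M` that carries the representative `(n : Q ⧸ M.map q).out` of the `M`-orbit
of `n` to `n`. -/
noncomputable def move (q : G →* Q) (M : Subgroup G) (n : Q) : G := (exists_move q M n).choose

theorem move_mem (q : G →* Q) (M : Subgroup G) (n : Q) : move q M n ∈ M :=
  (exists_move q M n).choose_spec.1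

theorem map_move_mul (q : G →* Q) (M : Subgroup G) (n : Q) :
    q (move q M n) * (n : Q ⧸ M.map q).out = n :=
  (exists_move q M n).choose_spec.2

theorem mk_map_mul (q : G →* Q) {M : Subgroup G} {g : G} (hg : g ∈ M) (n : Q) :
    ((q g * n : Q) : Q ⧸ M.map q) = (n : Q ⧸ M.map q) := by
  rw [QuotientGroup.eq]
  refine ⟨g⁻¹, M.inv_mem hg, ?_⟩
  rw [_root_.map_inv, mul_inv, mul_assoc, inv_mul_cancel, mul_one]

/-- Moving from the orbit representative to `n`, then by `g`, then back to the representative is a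
loop, so it lies in the kernel. -/
theorem move_conj_mem_ker (q : G →* Q) {M : Subgroup G} {g : G} (hg : g ∈ M) (n : Q) :
    (move q M (q g * n))⁻¹ * g * move q M n ∈ M ⊓ q.ker := by
  refine ⟨M.mul_mem (M.mul_mem (M.inv_mem (move_mem ..)) hg) (move_mem ..), ?_⟩
  have h1 := map_move_mul q M (q g * n)
  have h2 := map_move_mul q M n
  rw [mk_map_mul q hg] at h1
  change q _ = 1
  rw [map_mul, map_mul, _root_.map_inv, mul_assoc, inv_mul_eq_one]
  apply mul_right_cancel (b := (n : Q ⧸ M.map q).out)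
  rw [h1, mul_assoc, h2]

/-- Two cocycles on `M` whose restrictions to the stabilizer `M ⊓ q.ker` of each orbit representative
`d.out` are conjugate by `κ₀ d` are conjugate by a function `κ` on `Q` that extends `κ₀`. This holds
because the action groupoid of `M` is connected on each orbit. -/
theorem exists_gauge (q : G →* Q) {M : Subgroup G} {F F' : G → Q → H} (hF : IsCocycleOn q M F)
    (hF' : IsCocycleOn q M F') (κ₀ : Q ⧸ M.map q → H)
    (h : ∀ d : Q ⧸ M.map q, ∀ a ∈ M ⊓ q.ker, F a d.out * κ₀ d = κ₀ d * F' a d.out) :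
    ∃ κ : Q → H, (∀ g ∈ M, ∀ n, F g n * κ n = κ (q g * n) * F' g n) ∧
      ∀ d : Q ⧸ M.map q, κ d.out = κ₀ d := by
  refine ⟨fun n => F (move q M n) (n : Q ⧸ M.map q).out * κ₀ n *
    (F' (move q M n) (n : Q ⧸ M.map q).out)⁻¹, ?_, ?_⟩
  · intro g hg n
    have ha := move_conj_mem_ker q hg n
    simp only [mk_map_mul q hg]
    set d : Q ⧸ M.map q := (n : Q ⧸ M.map q) with hd
    set ε := move q M n with hε
    set ε' := move q M (q g * n) with hε'
    set a := ε'⁻¹ * g * ε with haa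
    have hεM : ε ∈ M := move_mem ..
    have hεM' : ε' ∈ M := move_mem ..
    have hga : g * ε = ε' * a := by rw [haa]; group
    have hb : q ε * d.out = n := map_move_mul ..
    have e1 := hF g hg ε hεM d.out
    have e2 := hF' g hg ε hεM d.out
    have e3 := hF ε' hεM' a ha.1 d.out
    have e4 := hF' ε' hεM' a ha.1 d.out
    have hqa : q a = 1 := ha.2
    rw [hb] at e1 e2
    rw [hqa, one_mul] at e3 e4
    rw [hga] at e1 e2
    have e5 := h d a ha
    have e6 : F g n = F ε' d.out * F a d.out * (F ε d.out)⁻¹ := by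
      rw [← e3, e1]; group
    have e7 : F' g n = F' ε' d.out * F' a d.out * (F' ε d.out)⁻¹ := by
      rw [← e4, e2]; group
    rw [e6, e7]
    calc _ = F ε' d.out * (F a d.out * κ₀ d) * (F' ε d.out)⁻¹ := by group
      _ = _ := by rw [e5]; group
  · intro d
    have hd : ((d.out : Q) : Q ⧸ M.map q) = d := QuotientGroup.out_eq' d
    simp only [hd]
    have hm : move q M d.out ∈ M ⊓ q.ker := by
      refine ⟨move_mem .., ?_⟩
      have := map_move_mul q M d.out
      rw [hd] at this
      simpa using this
    rw [h d _ hm]; group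

end Cocycles

/-- A graph of abelian subgroups of `G`: a subgroup `U i` for each vertex `i`, a subgroup `S j` for
each oriented edge `j`, contained in the subgroups of both ends. -/
structure SubgroupGraph (G : Type u) [Group G] where
  I : Type u
  J : Type u
  U : I → Subgroup G
  S : J → Subgroup G
  src : J → I
  tgt : J → I
  src_le : ∀ j, S j ≤ U (src j)
  tgt_le : ∀ j, S j ≤ U (tgt j)
  comm : ∀ i, ∀ a ∈ U i, ∀ b ∈ U i, a * b = b * a

namespace SubgroupGraph

variable {G Q : Type u} [Group G] [CommGroup Q]

/-- The covering graph of groups of `D` that belongs to `q : G →* Q`. Above the vertex `i` it has one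
vertex for each orbit of `U i` on `Q`, with group the stabilizer `U i ⊓ q.ker`, and similarly for
edges. An edge joins the orbits of the chosen representative of its own orbit. The subgroups are
abelian, so conjugating by elements that change the representative does nothing, and all edge maps
are plain inclusions. -/
noncomputable def cover (D : SubgroupGraph G) (q : G →* Q) : GraphOfGroups.{u} where
  Vert := Σ i, Q ⧸ (D.U i).map q
  Edge := Σ j, Q ⧸ (D.S j).map q
  src e := ⟨D.src e.1, (e.2.out : Q)⟩
  tgt e := ⟨D.tgt e.1, (e.2.out : Q)⟩
  VGroup v := ↥(D.U v.1 ⊓ q.ker)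
  EGroup e := ↥(D.S e.1 ⊓ q.ker)
  vgroup _ := inferInstance
  egroup _ := inferInstance
  srcMap e := Subgroup.inclusion (inf_le_inf_right _ (D.src_le e.1))
  tgtMap e := Subgroup.inclusion (inf_le_inf_right _ (D.tgt_le e.1))
  srcMap_injective _ := Subgroup.inclusion_injective _
  tgtMap_injective _ := Subgroup.inclusion_injective _

/-- A representation of the covering graph of groups in `H`: homomorphisms on the vertex groups and
an element for each edge, subject to the relations of the fundamental group apart from those that
kill a spanning tree. -/
def IsRep (D : SubgroupGraph G) (q : G →* Q) {H : Type*} [Group H]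
    (φ : ∀ i, Q ⧸ (D.U i).map q → ↥(D.U i ⊓ q.ker) →* H)
    (h : ∀ j, Q ⧸ (D.S j).map q → H) : Prop :=
  ∀ j (d : Q ⧸ (D.S j).map q) (a : ↥(D.S j ⊓ q.ker)),
    h j d * φ (D.tgt j) (d.out : Q) (Subgroup.inclusion (inf_le_inf_right _ (D.tgt_le j)) a) =
      φ (D.src j) (d.out : Q) (Subgroup.inclusion (inf_le_inf_right _ (D.src_le j)) a) * h j d

/-- If `τ i c` identifies the value of a representation at the vertex `(i, c)` with that of `F` at the
representative of the orbit `c`, this is the induced identification at an arbitrary point `n`. -/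
noncomputable def transport (D : SubgroupGraph G) (q : G →* Q) {H : Type*} [Group H]
    (F : G → Q → H) (τ : ∀ i, Q ⧸ (D.U i).map q → H) (i : D.I) (n : Q) : H :=
  τ i n * (F (move q (D.U i) n) (n : Q ⧸ (D.U i).map q).out)⁻¹

/-- The cocycle `F` restricts, up to the gauge transformation `τ`, to the representation `(φ, h)` of
the covering graph of groups. -/
def Induces (D : SubgroupGraph G) (q : G →* Q) {H : Type*} [Group H]
    (F : G → Q → H) (τ : ∀ i, Q ⧸ (D.U i).map q → H)
    (φ : ∀ i, Q ⧸ (D.U i).map q → ↥(D.U i ⊓ q.ker) →* H)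
    (h : ∀ j, Q ⧸ (D.S j).map q → H) : Prop :=
  (∀ i c (a : ↥(D.U i ⊓ q.ker)), τ i c * F a c.out = φ i c a * τ i c) ∧
  ∀ j (d : Q ⧸ (D.S j).map q),
    h j d * D.transport q F τ (D.tgt j) d.out = D.transport q F τ (D.src j) d.out

/-- Every representation of the covering graph of groups comes from a cocycle on `M`, up to gauge.
For `M = ⊤` this says that the relations of the fundamental group suffice to present `q.ker`. -/
def HasExtension (D : SubgroupGraph G) (q : G →* Q) (M : Subgroup G) : Prop :=
  ∀ (H : Type u) [Group H] (φ : ∀ i, Q ⧸ (D.U i).map q → ↥(D.U i ⊓ q.ker) →* H)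
    (h : ∀ j, Q ⧸ (D.S j).map q → H), D.IsRep q φ h →
    ∃ (F : G → Q → H) (τ : ∀ i, Q ⧸ (D.U i).map q → H), IsCocycleOn q M F ∧ D.Induces q F τ φ h

/-- The identification `transport` intertwines `F` and `φ` at every point of the orbit, since
`U i` is abelian. -/
theorem transport_mul (D : SubgroupGraph G) (q : G →* Q) {H : Type*} [Group H] {M : Subgroup G}
    {F : G → Q → H} (hF : IsCocycleOn q M F) {τ : ∀ i, Q ⧸ (D.U i).map q → H}
    {φ : ∀ i, Q ⧸ (D.U i).map q → ↥(D.U i ⊓ q.ker) →* H} {i : D.I} (hM : D.U i ≤ M)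
    (hτ : ∀ c (a : ↥(D.U i ⊓ q.ker)), τ i c * F a c.out = φ i c a * τ i c)
    (n : Q) (a : ↥(D.U i ⊓ q.ker)) :
    D.transport q F τ i n * F a n = φ i n a * D.transport q F τ i n := by
  unfold transport
  set c : Q ⧸ (D.U i).map q := (n : Q ⧸ (D.U i).map q)
  have hδ := move_mem q (D.U i) n
  have hb : q (move q (D.U i) n) * c.out = n := map_move_mul ..
  set δ := move q (D.U i) n
  have e1 := hF a (hM a.2.1) δ (hM hδ) c.out
  have e2 := hF δ (hM hδ) a (hM a.2.1) c.out
  have hqa : q a = 1 := a.2.2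
  rw [hb, D.comm i a a.2.1 δ hδ] at e1
  rw [hqa, one_mul] at e2
  have e3 : F a n = F δ c.out * F a c.out * (F δ c.out)⁻¹ := by
    rw [← e2, e1]; group
  rw [e3, ← mul_assoc (φ i c a), ← hτ c a]
  group

end SubgroupGraph

/-! ### Gluing the extension property -/

namespace SubgroupGraph

variable {G Q : Type u} [Group G] [CommGroup Q]

/-- The graph with one vertex, no edge, and the group `M`. -/
def single (M : Subgroup G) (hM : ∀ a ∈ M, ∀ b ∈ M, a * b = b * a) : SubgroupGraph G where
  I := PUnit
  J := PEmpty
  U _ := M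
  S := PEmpty.elim
  src := PEmpty.elim
  tgt := PEmpty.elim
  src_le j := j.elim
  tgt_le j := j.elim
  comm _ := hM

/-- The disjoint union of two graphs of subgroups with one more edge, which joins `i₁` to `i₂` and
has the group `S`. -/
def join (D₁ D₂ : SubgroupGraph G) (S : Subgroup G) (i₁ : D₁.I) (i₂ : D₂.I) (h₁ : S ≤ D₁.U i₁)
    (h₂ : S ≤ D₂.U i₂) : SubgroupGraph G where
  I := D₁.I ⊕ D₂.I
  J := (D₁.J ⊕ D₂.J) ⊕ PUnit
  U := Sum.elim D₁.U D₂.U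
  S := Sum.elim (Sum.elim D₁.S D₂.S) fun _ => S
  src := Sum.elim (Sum.map D₁.src D₂.src) fun _ => Sum.inl i₁
  tgt := Sum.elim (Sum.map D₁.tgt D₂.tgt) fun _ => Sum.inr i₂
  src_le := by
    rintro ((j | j) | _)
    exacts [D₁.src_le j, D₂.src_le j, h₁]
  tgt_le := by
    rintro ((j | j) | _)
    exacts [D₁.tgt_le j, D₂.tgt_le j, h₂]
  comm := by
    rintro (i | i)
    exacts [D₁.comm i, D₂.comm i]

theorem hasExtension_single (q : G →* Q) (M : Subgroup G)
    (hM : ∀ a ∈ M, ∀ b ∈ M, a * b = b * a) : (single M hM).HasExtension q M := by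
  intro H _ φ h _
  classical
  let φ' : Q ⧸ M.map q → ↥(M ⊓ q.ker) →* H := φ PUnit.unit
  refine ⟨fun g n => if hg : g ∈ M then φ' n ⟨_, move_conj_mem_ker q hg n⟩ else 1,
    fun _ _ => 1, ?_, ?_, fun j => j.elim⟩
  · intro g hg g' hg' n
    simp only [dif_pos hg, dif_pos hg', dif_pos (M.mul_mem hg hg')]
    have hn : ((q g' * n : Q) : Q ⧸ M.map q) = n := mk_map_mul q hg' n
    have key : ∀ c c' : Q ⧸ M.map q, c = c' → ∀ x y z : ↥(M ⊓ q.ker), x = y * z →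
        φ' c x = φ' c' y * φ' c z := by
      rintro c _ rfl x y z rfl
      exact map_mul _ _ _
    refine key _ _ hn.symm _ _ _ (Subtype.ext ?_)
    simp only [Subgroup.coe_mul, map_mul, mul_assoc]
    simp
  · rintro ⟨⟩ c a
    have ha : (a : G) ∈ M := a.2.1
    have hqa : q a = 1 := a.2.2
    simp only [dif_pos ha, one_mul, mul_one]
    have hc : ((c.out : Q) : Q ⧸ M.map q) = c := QuotientGroup.out_eq' c
    have key : ∀ c c' : Q ⧸ M.map q, c = c' → ∀ x y : ↥(M ⊓ q.ker), x = y → φ' c x = φ' c' y := by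
      rintro c _ rfl x _ rfl
      rfl
    refine key _ _ hc _ _ (Subtype.ext ?_)
    change (move q M (q a * c.out))⁻¹ * a * move q M c.out = a
    rw [hqa, one_mul, mul_assoc, hM a ha _ (move_mem ..), inv_mul_cancel_left]

/-- Cocycles on `M₁` and `M₂` that agree on `S` have a common extension to `M`. This is the part that
is needed of the statement that `M` is the amalgamated product of `M₁` and `M₂` over `S`. -/
def HasGluing (q : G →* Q) (M₁ M₂ S M : Subgroup G) : Prop :=
  ∀ (H : Type u) [Group H] (F₁ F₂ : G → Q → H), IsCocycleOn q M₁ F₁ → IsCocycleOn q M₂ F₂ →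
    (∀ g ∈ S, ∀ n, F₁ g n = F₂ g n) →
    ∃ F, IsCocycleOn q M F ∧ (∀ g ∈ M₁, F g = F₁ g) ∧ ∀ g ∈ M₂, F g = F₂ g

/-- Extend over both halves. The letters of the new edges identify the two cocycles on the stabilizers
in `S`, so by `exists_gauge` one of them can be changed by a gauge transformation until they agree on
`S`; then glue. -/
theorem hasExtension_join (q : G →* Q) {D₁ D₂ : SubgroupGraph G} {S : Subgroup G} {i₁ : D₁.I}
    {i₂ : D₂.I} (h₁ : S ≤ D₁.U i₁) (h₂ : S ≤ D₂.U i₂) {M₁ M₂ M : Subgroup G}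
    (hM₁ : ∀ i, D₁.U i ≤ M₁) (hM₂ : ∀ i, D₂.U i ≤ M₂)
    (hD₁ : D₁.HasExtension q M₁) (hD₂ : D₂.HasExtension q M₂) (hglue : HasGluing q M₁ M₂ S M) :
    (join D₁ D₂ S i₁ i₂ h₁ h₂).HasExtension q M := by
  intro H _ φ h hrep
  let φ₁ : ∀ i, Q ⧸ (D₁.U i).map q → ↥(D₁.U i ⊓ q.ker) →* H := fun i => φ (Sum.inl i)
  let φ₂ : ∀ i, Q ⧸ (D₂.U i).map q → ↥(D₂.U i ⊓ q.ker) →* H := fun i => φ (Sum.inr i)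
  obtain ⟨F₁, τ₁, hF₁, hI₁⟩ := hD₁ H φ₁ (fun j => h (Sum.inl (Sum.inl j)))
    (fun j => hrep (Sum.inl (Sum.inl j)))
  obtain ⟨F₂, τ₂, hF₂, hI₂⟩ := hD₂ H φ₂ (fun j => h (Sum.inl (Sum.inr j)))
    (fun j => hrep (Sum.inl (Sum.inr j)))
  let h₀ : Q ⧸ S.map q → H := h (Sum.inr PUnit.unit)
  let t₁ := D₁.transport q F₁ τ₁ i₁
  let t₂ := D₂.transport q F₂ τ₂ i₂
  have ht₁ := D₁.transport_mul q hF₁ (hM₁ i₁) (hI₁.1 i₁)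
  have ht₂ := D₂.transport_mul q hF₂ (hM₂ i₂) (hI₂.1 i₂)
  have hrep₀ : ∀ (d : Q ⧸ S.map q) (a : ↥(S ⊓ q.ker)),
      h₀ d * φ₂ i₂ (d.out : Q) (Subgroup.inclusion (inf_le_inf_right _ h₂) a) =
      φ₁ i₁ (d.out : Q) (Subgroup.inclusion (inf_le_inf_right _ h₁) a) * h₀ d :=
    hrep (Sum.inr PUnit.unit)
  obtain ⟨κ, hκ, hκ₀⟩ := exists_gauge q (hF₁.mono (h₁.trans (hM₁ i₁)))
    (hF₂.mono (h₂.trans (hM₂ i₂))) (fun d : Q ⧸ S.map q => (t₁ d.out)⁻¹ * h₀ d * t₂ d.out) (by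
      intro d a ha
      have e₁ := ht₁ d.out ⟨a, inf_le_inf_right _ h₁ ha⟩
      have e₂ := ht₂ d.out ⟨a, inf_le_inf_right _ h₂ ha⟩
      have e₀ := hrep₀ d ⟨a, ha⟩
      change t₁ d.out * F₁ a d.out = _ * t₁ d.out at e₁
      change t₂ d.out * F₂ a d.out = _ * t₂ d.out at e₂
      have e₁' : F₁ a d.out * (t₁ d.out)⁻¹ = (t₁ d.out)⁻¹ *
          φ₁ i₁ (d.out : Q) ⟨a, inf_le_inf_right _ h₁ ha⟩ := by
        rw [mul_inv_eq_iff_eq_mul, mul_assoc, ← e₁, inv_mul_cancel_left]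
      calc _ = F₁ a d.out * (t₁ d.out)⁻¹ * h₀ d * t₂ d.out := by group
        _ = (t₁ d.out)⁻¹ * (h₀ d * φ₂ i₂ (d.out : Q) ⟨a, inf_le_inf_right _ h₂ ha⟩) *
              t₂ d.out := by
            rw [e₁', mul_assoc (t₁ d.out)⁻¹]
            exact congrArg (fun x => (t₁ d.out)⁻¹ * x * t₂ d.out) e₀.symm
        _ = _ := by rw [mul_assoc, mul_assoc (h₀ d), ← e₂]; group)
  let F₂' : G → Q → H := fun g n => κ (q g * n) * F₂ g n * (κ n)⁻¹
  have hF₂' : IsCocycleOn q M₂ F₂' := by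
    intro g hg g' hg' n
    simp only [F₂', hF₂ g hg g' hg' n, map_mul, mul_assoc, inv_mul_cancel_left]
  obtain ⟨F, hF, hFF₁, hFF₂⟩ := hglue H F₁ F₂' hF₁ hF₂' (by
    intro g hg n
    simp only [F₂', ← hκ g hg n, mul_inv_cancel_right])
  have htr₁ : ∀ i n, (join D₁ D₂ S i₁ i₂ h₁ h₂).transport q F
      (Sum.rec τ₁ fun i c => τ₂ i c * (κ c.out)⁻¹) (Sum.inl i) n = D₁.transport q F₁ τ₁ i n := by
    intro i n
    change τ₁ i n * (F (move q (D₁.U i) n) (n : Q ⧸ (D₁.U i).map q).out)⁻¹ = _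
    rw [hFF₁ _ (hM₁ i (move_mem ..))]
    rfl
  have htr₂ : ∀ i n, (join D₁ D₂ S i₁ i₂ h₁ h₂).transport q F
      (Sum.rec τ₁ fun i c => τ₂ i c * (κ c.out)⁻¹) (Sum.inr i) n =
        D₂.transport q F₂ τ₂ i n * (κ n)⁻¹ := by
    intro i n
    change (τ₂ i n * (κ (n : Q ⧸ (D₂.U i).map q).out)⁻¹) *
      (F (move q (D₂.U i) n) (n : Q ⧸ (D₂.U i).map q).out)⁻¹ = _
    rw [hFF₂ _ (hM₂ i (move_mem ..))]
    simp only [F₂', map_move_mul, transport]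
    group
  have hind₂ : ∀ i (c : Q ⧸ (D₂.U i).map q) (a : ↥(D₂.U i ⊓ q.ker)),
      τ₂ i c * (κ c.out)⁻¹ * F a c.out = φ₂ i c a * (τ₂ i c * (κ c.out)⁻¹) := by
    intro i c a
    have hqa : q a = 1 := a.2.2
    rw [hFF₂ _ (hM₂ i a.2.1), ← mul_assoc (φ₂ i c a), ← hI₂.1 i c a]
    simp only [F₂', hqa, one_mul]
    group
  refine ⟨F, Sum.rec τ₁ fun i c => τ₂ i c * (κ c.out)⁻¹, hF, ?_, ?_⟩
  · rintro (i | i) c a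
    · change τ₁ i c * F a c.out = φ₁ i c a * τ₁ i c
      rw [hFF₁ _ (hM₁ i a.2.1)]
      exact hI₁.1 i c a
    · exact hind₂ i c a
  · rintro ((j | j) | ⟨⟩) d
    · exact ((congrArg _ (htr₁ _ _)).trans (hI₁.2 j d)).trans (htr₁ _ _).symm
    · refine ((congrArg _ (htr₂ _ _)).trans ?_).trans (htr₂ _ _).symm
      rw [← mul_assoc]
      exact congrArg (· * _) (hI₂.2 j d)
    · refine ((congrArg _ (htr₂ _ _)).trans ?_).trans (htr₁ _ _).symm
      have e := hκ₀ d
      change κ d.out = (t₁ d.out)⁻¹ * h₀ d * t₂ d.out at e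
      change h₀ d * (t₂ d.out * (κ d.out)⁻¹) = t₁ d.out
      rw [e]; group

end SubgroupGraph

/-! ### Trees, fundamental groups and the splitting of the kernel -/

/-- On a tree, any assignment of group elements to the oriented edges is a coboundary. -/
theorem exists_gauge_of_isTree {V G : Type*} [Group G] {T : SimpleGraph V} (hT : T.IsTree)
    (y : V → V → G) (hy : ∀ u v, T.Adj u v → y v u = (y u v)⁻¹) (r : V) (g : G) :
    ∃ γ : V → G, γ r = g ∧ ∀ u v, T.Adj u v → γ v = γ u * y u v := by
  classical
  let w : ∀ {a b : V}, T.Walk a b → G := fun p =>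
    (p.darts.map fun d => y d.fst d.snd).prod
  choose p hp _ using fun v => hT.existsUnique_path r v
  have key : ∀ u v, T.Adj u v → u ∈ (p v).support → w (p v) = w (p u) * y u v := by
    intro u v h hu
    have e := hT.isAcyclic.path_concat (hp u) (hp v) h hu
    simp only [w]
    rw [e, SimpleGraph.Walk.darts_concat]
    simp
  refine ⟨fun v => g * w (p v), ?_, ?_⟩
  · have : p r = SimpleGraph.Walk.nil := SimpleGraph.Walk.eq_nil_iff_nil.2 (SimpleGraph.Walk.isPath_iff_nil.1 (hp r))
    simp [this, w]
  · intro u v h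
    by_cases hu : u ∈ (p v).support
    · simp only [key u v h hu, mul_assoc]
    · have hv := hT.isAcyclic.mem_support_of_ne_mem_support_of_adj_of_isPath (hp u) (hp v) h hu
      simp only [key v u h.symm hv, hy u v h]
      group

namespace GraphOfGroups

variable (𝒢 : GraphOfGroups.{u}) (T : Set 𝒢.Edge)

theorem exists_isSpanningTree
    (h : (SimpleGraph.fromEdgeSet (Set.range fun e => s(𝒢.src e, 𝒢.tgt e))).Connected) :
    ∃ T, 𝒢.IsSpanningTree T := by
  obtain ⟨T₀, hle, hT₀⟩ := h.exists_isTree_le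
  have hex : ∀ s : T₀.edgeSet, ∃ e, s(𝒢.src e, 𝒢.tgt e) = (s : Sym2 𝒢.Vert) := by
    rintro ⟨s, hs⟩
    have := SimpleGraph.edgeSet_mono hle hs
    rw [SimpleGraph.edgeSet_fromEdgeSet] at this
    exact this.1
  choose c hc using hex
  refine ⟨Set.range c, ?_, ?_, ?_⟩
  · rintro _ ⟨s, rfl⟩ heq
    have := hc s
    rw [heq] at this
    have h2 := T₀.not_isDiag_of_mem_edgeSet s.2
    rw [← this] at h2
    exact h2 rfl
  · rintro _ ⟨s, rfl⟩ _ ⟨s', rfl⟩ heq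
    simp only [hc] at heq
    rw [Subtype.ext heq]
  · have : (fun e => s(𝒢.src e, 𝒢.tgt e)) '' Set.range c = T₀.edgeSet := by
      rw [← Set.range_comp]
      ext s
      constructor
      · rintro ⟨t, rfl⟩
        simp only [Function.comp, hc]
        exact t.2
      · intro hs
        exact ⟨⟨s, hs⟩, hc _⟩
    rw [this, SimpleGraph.fromEdgeSet_edgeSet]
    exact hT₀

variable {𝒢 T} in
/-- The version of `exists_gauge_of_isTree` for a spanning tree of a graph of groups. -/
theorem IsSpanningTree.exists_gauge (hT : 𝒢.IsSpanningTree T) {G : Type*} [Group G]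
    (x : 𝒢.Edge → G) (r : 𝒢.Vert) (g : G) :
    ∃ γ : 𝒢.Vert → G, γ r = g ∧ ∀ e ∈ T, γ (𝒢.tgt e) = γ (𝒢.src e) * x e := by
  classical
  obtain ⟨hloop, hinj, htree⟩ := hT
  let P : Sym2 𝒢.Vert → 𝒢.Edge → Prop := fun s e => e ∈ T ∧ s(𝒢.src e, 𝒢.tgt e) = s
  let y : 𝒢.Vert → 𝒢.Vert → G := fun u v =>
    if h : ∃ e, P s(u, v) e then (if 𝒢.src h.choose = u then x h.choose else (x h.choose)⁻¹) else 1
  have hy : ∀ e ∈ T, y (𝒢.src e) (𝒢.tgt e) = x e ∧ y (𝒢.tgt e) (𝒢.src e) = (x e)⁻¹ := by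
    intro e he
    have h1 : ∃ e', P s(𝒢.src e, 𝒢.tgt e) e' := ⟨e, he, rfl⟩
    have h2 : ∃ e', P s(𝒢.tgt e, 𝒢.src e) e' := ⟨e, he, Sym2.eq_swap⟩
    have e1 : h1.choose = e := hinj h1.choose_spec.1 he h1.choose_spec.2
    have e2 : h2.choose = e :=
      hinj h2.choose_spec.1 he (h2.choose_spec.2.trans Sym2.eq_swap)
    simp only [y, dif_pos h1, dif_pos h2, e1, e2, if_true, if_neg (hloop e he), and_self]
  have hadj : ∀ u v, (SimpleGraph.fromEdgeSet
      ((fun e => s(𝒢.src e, 𝒢.tgt e)) '' T)).Adj u v → ∃ e ∈ T, s(𝒢.src e, 𝒢.tgt e) = s(u, v) := by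
    intro u v h
    rw [SimpleGraph.fromEdgeSet_adj] at h
    exact h.1
  obtain ⟨γ, hγr, hγ⟩ := exists_gauge_of_isTree htree y (by
    intro u v h
    obtain ⟨e, he, heq⟩ := hadj u v h
    rcases Sym2.eq_iff.1 heq with ⟨rfl, rfl⟩ | ⟨rfl, rfl⟩
    · rw [(hy e he).1, (hy e he).2]
    · rw [(hy e he).1, (hy e he).2, inv_inv]) r g
  refine ⟨γ, hγr, fun e he => ?_⟩
  rw [hγ (𝒢.src e) (𝒢.tgt e), (hy e he).1]
  rw [SimpleGraph.fromEdgeSet_adj]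
  exact ⟨⟨e, he, rfl⟩, hloop e he⟩

variable {𝒢 T} in
theorem IsSpanningTree.eq_of_forall_mem (hT : 𝒢.IsSpanningTree T) {X : Type*} (f : 𝒢.Vert → X)
    (hf : ∀ e ∈ T, f (𝒢.src e) = f (𝒢.tgt e)) (v w : 𝒢.Vert) : f v = f w := by
  obtain ⟨p⟩ := hT.2.2.connected.preconnected v w
  induction p with
  | nil => rfl
  | @cons u v w h p ih =>
    rw [← ih]
    rw [SimpleGraph.fromEdgeSet_adj] at h
    obtain ⟨⟨e, he, heq⟩, -⟩ := h
    rcases Sym2.eq_iff.1 heq with ⟨rfl, rfl⟩ | ⟨rfl, rfl⟩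
    exacts [hf e he, (hf e he).symm]

/-- The homomorphism from a vertex group to the fundamental group. -/
def vertHom (v : 𝒢.Vert) : 𝒢.VGroup v →* 𝒢.FundamentalGroup T :=
  (QuotientGroup.mk' _).comp (𝒢.vert v)

/-- The element of the fundamental group given by the letter of an edge. -/
def edgeElt (e : 𝒢.Edge) : 𝒢.FundamentalGroup T := QuotientGroup.mk' _ (𝒢.letter e)

theorem edgeElt_of_mem {e : 𝒢.Edge} (he : e ∈ T) : 𝒢.edgeElt T e = 1 :=
  (QuotientGroup.eq_one_iff _).2 (Subgroup.subset_normalClosure (Or.inr ⟨e, he, rfl⟩))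

theorem edgeElt_mul (e : 𝒢.Edge) (a : 𝒢.EGroup e) :
    𝒢.edgeElt T e * 𝒢.vertHom T _ (𝒢.tgtMap e a) =
      𝒢.vertHom T _ (𝒢.srcMap e a) * 𝒢.edgeElt T e := by
  have : 𝒢.edgeElt T e * 𝒢.vertHom T _ (𝒢.tgtMap e a) * (𝒢.edgeElt T e)⁻¹ *
      (𝒢.vertHom T _ (𝒢.srcMap e a))⁻¹ = 1 :=
    (QuotientGroup.eq_one_iff _).2 (Subgroup.subset_normalClosure (Or.inl ⟨e, a, rfl⟩))
  rwa [mul_inv_eq_one, mul_inv_eq_iff_eq_mul] at this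

variable {𝒢 T}

theorem FundamentalGroup.hom_ext {H : Type*} [Group H] {Φ Ψ : 𝒢.FundamentalGroup T →* H}
    (hv : ∀ v a, Φ (𝒢.vertHom T v a) = Ψ (𝒢.vertHom T v a))
    (he : ∀ e, Φ (𝒢.edgeElt T e) = Ψ (𝒢.edgeElt T e)) : Φ = Ψ := by
  apply QuotientGroup.monoidHom_ext
  apply Monoid.Coprod.hom_ext
  · apply Monoid.CoprodI.ext_hom
    intro v
    ext a
    exact hv v a
  · apply FreeGroup.ext_hom
    exact he

theorem FundamentalGroup.exists_hom {H : Type*} [Group H] (φ : ∀ v, 𝒢.VGroup v →* H)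
    (h : 𝒢.Edge → H) (hrel : ∀ e a, h e * φ _ (𝒢.tgtMap e a) = φ _ (𝒢.srcMap e a) * h e)
    (hT : ∀ e ∈ T, h e = 1) :
    ∃ Φ : 𝒢.FundamentalGroup T →* H, (∀ v a, Φ (𝒢.vertHom T v a) = φ v a) ∧
      ∀ e, Φ (𝒢.edgeElt T e) = h e := by
  let Ψ : 𝒢.BigProduct →* H := Monoid.Coprod.lift (Monoid.CoprodI.lift φ) (FreeGroup.lift h)
  have hv : ∀ v a, Ψ (𝒢.vert v a) = φ v a := by
    intro v a
    simp [Ψ, vert]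
  have he : ∀ e, Ψ (𝒢.letter e) = h e := by
    intro e
    simp [Ψ, letter]
  refine ⟨QuotientGroup.lift _ Ψ ?_, hv, he⟩
  refine Subgroup.normalClosure_le_normal ?_
  rintro _ (⟨e, a, rfl⟩ | ⟨e, he', rfl⟩)
  · change Ψ _ = 1
    simp only [map_mul, map_inv, hv, he]
    rw [hrel, mul_inv_cancel_right, mul_inv_cancel]
  · change Ψ _ = 1
    rw [he, hT e he']

end GraphOfGroups

namespace SubgroupGraph

variable {G Q : Type u} [Group G] [CommGroup Q] (D : SubgroupGraph G) (q : G →* Q)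

/-- The underlying graph is connected. -/
def IsConnected : Prop :=
  ∀ i i', Relation.EqvGen (fun a b => ∃ j, D.src j = a ∧ D.tgt j = b) i i'

theorem mk_out_eq_mk {M N : Subgroup G} (h : M ≤ N) (n : Q) :
    (((n : Q ⧸ M.map q).out : Q) : Q ⧸ N.map q) = n := by
  have := mk_map_mul q (h (move_mem q M n)) (n : Q ⧸ M.map q).out
  rw [map_move_mul] at this
  exact this.symm

theorem cover_src_mk (j : D.J) (n : Q) :
    (D.cover q).src ⟨j, (n : Q ⧸ (D.S j).map q)⟩ = ⟨D.src j, (n : Q ⧸ (D.U (D.src j)).map q)⟩ :=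
  Sigma.ext rfl (heq_of_eq (mk_out_eq_mk q (D.src_le j) n))

theorem cover_tgt_mk (j : D.J) (n : Q) :
    (D.cover q).tgt ⟨j, (n : Q ⧸ (D.S j).map q)⟩ = ⟨D.tgt j, (n : Q ⧸ (D.U (D.tgt j)).map q)⟩ :=
  Sigma.ext rfl (heq_of_eq (mk_out_eq_mk q (D.tgt_le j) n))

variable {D q}

theorem cover_connected (hq : Function.Surjective q) [hI : Nonempty D.I] (hD : D.IsConnected)
    (hgen : ⨆ i, D.U i = ⊤) :
    (SimpleGraph.fromEdgeSet
      (Set.range fun e => s((D.cover q).src e, (D.cover q).tgt e))).Connected := by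
  set Gr := SimpleGraph.fromEdgeSet
      (Set.range fun e => s((D.cover q).src e, (D.cover q).tgt e)) with hGr
  let pt : D.I → Q → (D.cover q).Vert := fun i n => ⟨i, (n : Q ⧸ (D.U i).map q)⟩
  have hsame : ∀ i i' n, Gr.Reachable (pt i n) (pt i' n) := by
    intro i i' n
    induction hD i i' with
    | rel i i' h =>
      obtain ⟨j, rfl, rfl⟩ := h
      by_cases heq : pt (D.src j) n = pt (D.tgt j) n
      · rw [heq]
      · refine SimpleGraph.Adj.reachable ?_
        rw [hGr, SimpleGraph.fromEdgeSet_adj]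
        refine ⟨⟨⟨j, (n : Q ⧸ (D.S j).map q)⟩, ?_⟩, heq⟩
        change s(_, _) = _
        rw [cover_src_mk, cover_tgt_mk]
    | refl => rfl
    | symm _ _ _ ih => exact ih.symm
    | trans _ _ _ _ _ ih ih' => exact ih.trans ih'
  obtain ⟨i₀⟩ := hI
  have hmove : ∀ g : G, ∀ n, Gr.Reachable (pt i₀ n) (pt i₀ (q g * n)) := by
    intro g
    have hg : g ∈ ⨆ i, D.U i := by rw [hgen]; trivial
    induction hg using Subgroup.iSup_induction' with
    | hp i g hg =>
      intro n
      have : pt i (q g * n) = pt i n := Sigma.ext rfl (heq_of_eq (mk_map_mul q hg n))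
      have h := hsame i i₀ (q g * n)
      rw [this] at h
      exact (hsame i₀ i n).trans h
    | h1 => intro n; rw [map_one, one_mul]
    | hmul g g' _ _ ih ih' =>
      intro n
      rw [map_mul, mul_assoc]
      exact (ih' n).trans (ih _)
  have hbase : ∀ v, Gr.Reachable (pt i₀ 1) v := by
    rintro ⟨i, c⟩
    obtain ⟨n, rfl⟩ := QuotientGroup.mk_surjective c
    obtain ⟨g, rfl⟩ := hq n
    have := hmove g 1
    rw [mul_one] at this
    exact this.trans (hsame _ _ _)
  have : Nonempty (D.cover q).Vert := ⟨pt i₀ 1⟩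
  exact ⟨fun u v => (hbase u).symm.trans (hbase v)⟩

/-- A subgroup `K₀` contains `q.ker` as soon as it contains all vertex groups, conjugated by `γ`, and
the corresponding elements for the edges. Writing `γ'` for the extension of `γ` to all points of the
orbits, the coset `K₀ * γ' i n` does not depend on `i`, by connectedness, and multiplication by
`g ∈ U i` carries the coset at `n` to the one at `q g * n`; the `U i` generate `G`. -/
theorem ker_le_of_conj_mem [hI : Nonempty D.I] (hD : D.IsConnected) (hgen : ⨆ i, D.U i = ⊤)
    (γ : ∀ i, Q ⧸ (D.U i).map q → G) (K₀ : Subgroup G)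
    (hvert : ∀ i c, ∀ a ∈ D.U i ⊓ q.ker, γ i c * a * (γ i c)⁻¹ ∈ K₀)
    (hedge : ∀ j (d : Q ⧸ (D.S j).map q), γ (D.src j) (d.out : Q) *
      ((move q (D.U (D.src j)) d.out)⁻¹ * move q (D.U (D.tgt j)) d.out) *
        (γ (D.tgt j) (d.out : Q))⁻¹ ∈ K₀) : q.ker ≤ K₀ := by
  let γ' : D.I → Q → G := fun i n => γ i n * (move q (D.U i) n)⁻¹
  have s1 : ∀ i, ∀ g ∈ D.U i, ∀ n, γ' i (q g * n) * g * (γ' i n)⁻¹ ∈ K₀ := by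
    intro i g hg n
    have := hvert i n _ (move_conj_mem_ker q hg n)
    simp only [γ', mk_map_mul q hg]
    convert this using 1
    group
  have s2 : ∀ j n, γ' (D.src j) n * (γ' (D.tgt j) n)⁻¹ ∈ K₀ := by
    intro j n
    let d : Q ⧸ (D.S j).map q := n
    have hgS := move_mem q (D.S j) n
    have hgn : q (move q (D.S j) n) * d.out = n := map_move_mul ..
    set g := move q (D.S j) n
    have h1 := s1 _ g (D.src_le j hgS) d.out
    have h2 := s1 _ g (D.tgt_le j hgS) d.out
    rw [hgn] at h1 h2
    have h3 : γ' (D.src j) d.out * (γ' (D.tgt j) d.out)⁻¹ ∈ K₀ := by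
      have := hedge j d
      simp only [γ']
      convert this using 1
      group
    have := K₀.mul_mem (K₀.mul_mem h1 h3) (K₀.inv_mem h2)
    convert this using 1
    group
  have s3 : ∀ i i' n, γ' i n * (γ' i' n)⁻¹ ∈ K₀ := by
    intro i i' n
    induction hD i i' with
    | rel i i' h =>
      obtain ⟨j, rfl, rfl⟩ := h
      exact s2 j n
    | refl => rw [mul_inv_cancel]; exact K₀.one_mem
    | symm _ _ _ ih =>
      have := K₀.inv_mem ih
      rwa [mul_inv_rev, inv_inv] at this
    | trans _ _ _ _ _ ih ih' =>
      have := K₀.mul_mem ih ih'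
      rwa [mul_assoc, inv_mul_cancel_left] at this
  obtain ⟨i₀⟩ := hI
  have s4 : ∀ g : G, ∀ n, γ' i₀ (q g * n) * g * (γ' i₀ n)⁻¹ ∈ K₀ := by
    intro g
    have hg : g ∈ ⨆ i, D.U i := by rw [hgen]; trivial
    induction hg using Subgroup.iSup_induction' with
    | hp i g hg =>
      intro n
      have := K₀.mul_mem (K₀.mul_mem (s3 i₀ i (q g * n)) (s1 i g hg n)) (s3 i i₀ n)
      convert this using 1
      group
    | h1 =>
      intro n
      rw [map_one, one_mul, mul_one, mul_inv_cancel]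
      exact K₀.one_mem
    | hmul g g' _ _ ih ih' =>
      intro n
      have := K₀.mul_mem (ih (q g' * n)) (ih' n)
      rw [map_mul, mul_assoc]
      convert this using 1
      group
  intro k hk
  have hk' : (γ' i₀ 1)⁻¹ * k * γ' i₀ 1 ∈ q.ker := by
    have := (inferInstance : q.ker.Normal).conj_mem k hk (γ' i₀ 1)⁻¹
    rwa [inv_inv] at this
  have := s4 ((γ' i₀ 1)⁻¹ * k * γ' i₀ 1) 1
  rw [MonoidHom.mem_ker.1 hk', one_mul] at this
  convert this using 1
  group

variable (D q) in
/-- The inclusion of a vertex group of the covering graph of groups in `G`. -/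
def vertVal (v : (D.cover q).Vert) : (D.cover q).VGroup v →* G := Subgroup.subtype (D.U v.1 ⊓ q.ker)

variable (D q) in
/-- The inclusion of an edge group of the covering graph of groups in `G`. -/
def edgeVal (e : (D.cover q).Edge) : (D.cover q).EGroup e →* G := Subgroup.subtype (D.S e.1 ⊓ q.ker)

/-- The kernel of `q` is the fundamental group of the covering graph of groups. Paths along a spanning
tree give a homomorphism `Φ` from the fundamental group to the kernel. It is surjective by
`ker_le_of_conj_mem`. Extending the tautological representation of the fundamental group to a cocycle
on `G` and restricting to the kernel gives a homomorphism `Θ` in the other direction, and `Θ ∘ Φ` is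
an inner automorphism, so `Φ` is injective. -/
theorem splitsAs_cover (hq : Function.Surjective q) [Nonempty D.I] (hD : D.IsConnected)
    (hgen : ⨆ i, D.U i = ⊤) (hext : D.HasExtension q ⊤) : SplitsAs q.ker (D.cover q) := by
  have hconn := cover_connected hq hD hgen
  obtain ⟨T, hT⟩ := (D.cover q).exists_isSpanningTree hconn
  refine ⟨T, hT, ?_⟩
  let P := (D.cover q).FundamentalGroup T
  let b : (D.cover q).Vert → Q := fun v => v.2.out
  let α : (D.cover q).Edge → G := fun e => move q (D.U (D.src e.1)) e.2.out
  let β : (D.cover q).Edge → G := fun e => move q (D.U (D.tgt e.1)) e.2.out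
  have hα : ∀ e, q (α e) * b ((D.cover q).src e) = e.2.out := fun e => map_move_mul ..
  have hβ : ∀ e, q (β e) * b ((D.cover q).tgt e) = e.2.out := fun e => map_move_mul ..
  obtain ⟨r⟩ : Nonempty (D.cover q).Vert := hconn.nonempty
  obtain ⟨g₀, hg₀⟩ := hq (b r)⁻¹
  obtain ⟨γ, hγr, hγ⟩ := hT.exists_gauge (fun e => (α e)⁻¹ * β e) r g₀
  -- `γ v` carries the representative `b v` to the base point `1` of `Q`
  have hγb : ∀ v, q (γ v) = (b v)⁻¹ := by
    have hstep : ∀ e ∈ T, q (γ ((D.cover q).tgt e)) * b ((D.cover q).tgt e) =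
        q (γ ((D.cover q).src e)) * b ((D.cover q).src e) := by
      intro e he
      have h2 : q (α e)⁻¹ * (q (β e) * b ((D.cover q).tgt e)) = b ((D.cover q).src e) := by
        rw [hβ, ← hα, map_inv, inv_mul_cancel_left]
      rw [hγ e he, map_mul, map_mul, mul_assoc, mul_assoc, h2]
    intro v
    refine eq_inv_of_mul_eq_one_left ?_
    rw [hT.eq_of_forall_mem (fun v => q (γ v) * b v) (fun e he => (hstep e he).symm) v r, hγr, hg₀,
      inv_mul_cancel]
  have hletter : ∀ e, γ ((D.cover q).src e) * ((α e)⁻¹ * β e) * (γ ((D.cover q).tgt e))⁻¹ ∈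
      q.ker := by
    intro e
    have h1 := hα e
    have h2 := hβ e
    rw [← h1] at h2
    rw [MonoidHom.mem_ker, map_mul, map_mul, map_mul, map_inv, map_inv, hγb, hγb, inv_inv,
      mul_assoc, mul_assoc, h2, inv_mul_cancel_left, inv_mul_cancel]
  obtain ⟨Φ, hΦv, hΦe⟩ := GraphOfGroups.FundamentalGroup.exists_hom (𝒢 := D.cover q) (T := T)
    (H := q.ker) (fun v => ((MulAut.conj (γ v)).toMonoidHom.comp (D.vertVal q v)).codRestrict q.ker
      (fun a => (inferInstance : q.ker.Normal).conj_mem _ a.2.2 (γ v)))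
    (fun e => ⟨_, hletter e⟩) (by
      intro e a
      refine Subtype.ext ?_
      have ha : D.edgeVal q e a ∈ D.S e.1 := a.2.1
      change γ ((D.cover q).src e) * ((α e)⁻¹ * β e) * (γ ((D.cover q).tgt e))⁻¹ *
        (γ ((D.cover q).tgt e) * D.edgeVal q e a * (γ ((D.cover q).tgt e))⁻¹) =
        γ ((D.cover q).src e) * D.edgeVal q e a * (γ ((D.cover q).src e))⁻¹ *
          (γ ((D.cover q).src e) * ((α e)⁻¹ * β e) * (γ ((D.cover q).tgt e))⁻¹)
      generalize D.edgeVal q e a = a at ha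
      have h1 : Commute (β e) a := D.comm _ _ (move_mem ..) _ (D.tgt_le _ ha)
      have h2 : Commute (α e) a := D.comm _ _ (move_mem ..) _ (D.src_le _ ha)
      have h3 : (α e)⁻¹ * β e * a = a * ((α e)⁻¹ * β e) := h2.inv_left.mul_left h1
      calc _ = γ ((D.cover q).src e) * ((α e)⁻¹ * β e * a) * (γ ((D.cover q).tgt e))⁻¹ := by group
        _ = _ := by rw [h3]; group)
    (by
      intro e he
      refine Subtype.ext ?_
      change γ ((D.cover q).src e) * ((α e)⁻¹ * β e) * (γ ((D.cover q).tgt e))⁻¹ = 1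
      rw [← hγ e he, mul_inv_cancel])
  have hΦv' : ∀ v a,
      ((Φ ((D.cover q).vertHom T v a) : q.ker) : G) = γ v * D.vertVal q v a * (γ v)⁻¹ := fun v a =>
    congrArg Subtype.val (hΦv v a)
  have hΦe' : ∀ e, ((Φ ((D.cover q).edgeElt T e) : q.ker) : G) =
      γ ((D.cover q).src e) * ((α e)⁻¹ * β e) * (γ ((D.cover q).tgt e))⁻¹ := fun e =>
    congrArg Subtype.val (hΦe e)
  refine ⟨(MulEquiv.ofBijective Φ ⟨?_, ?_⟩).symm⟩
  · obtain ⟨F, τ, hF, hI⟩ := hext P (fun i c => (D.cover q).vertHom T ⟨i, c⟩)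
      (fun j d => (D.cover q).edgeElt T ⟨j, d⟩)
      (fun j d a => (D.cover q).edgeElt_mul T ⟨j, d⟩ a)
    let Θ : q.ker →* P :=
      { toFun := fun k => F k 1
        map_one' := hF.map_one 1
        map_mul' := fun k k' => by
          have := hF k trivial k' trivial 1
          rwa [MonoidHom.mem_ker.1 k'.2, one_mul] at this }
    -- `η v` measures the gauge of `F` along the path from `v` to the base point; as letters of the
    -- tree are trivial, it does not depend on `v`
    let η : (D.cover q).Vert → P := fun v => F (γ v) (b v) * (τ v.1 v.2)⁻¹
    have hinv : ∀ v, F (γ v)⁻¹ 1 = (F (γ v) (b v))⁻¹ := by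
      intro v
      rw [hF.map_inv trivial, map_inv, hγb, inv_inv, mul_one]
    have hΘv : ∀ v a, Θ (Φ ((D.cover q).vertHom T v a)) =
        η v * (D.cover q).vertHom T v a * (η v)⁻¹ := by
      intro v a
      change F (Φ ((D.cover q).vertHom T v a) : q.ker) 1 = _
      have h1 := hI.1 v.1 v.2 a
      change τ v.1 v.2 * F (D.vertVal q v a) (b v) =
        (D.cover q).vertHom T v a * τ v.1 v.2 at h1
      have hqa : q (D.vertVal q v a) = 1 := a.2.2
      rw [hΦv', hF _ trivial _ trivial, hF _ trivial _ trivial, hinv, map_inv, hγb, inv_inv,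
        mul_one, hqa, one_mul]
      simp only [η]
      rw [eq_mul_inv_of_mul_eq h1.symm]
      group
    have halg : ∀ x t₁ t₂ f₁ f₂ g₁ g₂ : P, x * (t₂ * f₂⁻¹) = t₁ * f₁⁻¹ →
        g₁ * (f₁⁻¹ * f₂) * g₂⁻¹ = g₁ * t₁⁻¹ * x * (g₂ * t₂⁻¹)⁻¹ := by
      intro x t₁ t₂ f₁ f₂ g₁ g₂ h
      rw [eq_mul_inv_of_mul_eq h]
      group
    have hΘe : ∀ e, Θ (Φ ((D.cover q).edgeElt T e)) =
        η ((D.cover q).src e) * (D.cover q).edgeElt T e * (η ((D.cover q).tgt e))⁻¹ := by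
      intro e
      change F (Φ ((D.cover q).edgeElt T e) : q.ker) 1 = _
      have h1 := hI.2 e.1 e.2
      set s := (D.cover q).src e with hs
      set t := (D.cover q).tgt e with ht
      change (D.cover q).edgeElt T e * (τ t.1 t.2 * (F (β e) (b t))⁻¹) =
        τ s.1 s.2 * (F (α e) (b s))⁻¹ at h1
      have h2 : q (α e)⁻¹ * e.2.out = b s := by rw [← hα e, map_inv, inv_mul_cancel_left]
      rw [hΦe', hF _ trivial _ trivial, hF _ trivial _ trivial, hF _ trivial _ trivial, hinv,
        map_inv, hγb, inv_inv, mul_one, map_mul, mul_assoc (q _), hβ, h2, hF.map_inv trivial, h2]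
      exact halg _ _ _ _ _ _ _ h1
    have hη : ∀ v, η v = η r := by
      intro v
      refine hT.eq_of_forall_mem η (fun e he => ?_) v r
      have := hΘe e
      rw [(D.cover q).edgeElt_of_mem T he, map_one, map_one, mul_one] at this
      exact (mul_inv_eq_one.1 this.symm)
    have hcomp : Θ.comp Φ = (MulAut.conj (η r)).toMonoidHom := by
      refine GraphOfGroups.FundamentalGroup.hom_ext (fun v a => ?_) (fun e => ?_)
      · change Θ (Φ _) = _
        rw [hΘv, hη]
        rfl
      · change Θ (Φ _) = _
        rw [hΘe, hη ((D.cover q).src e), hη ((D.cover q).tgt e)]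
        rfl
    have hinj : Function.Injective (Θ.comp Φ) := by
      rw [hcomp]
      exact (MulAut.conj (η r)).injective
    exact Function.Injective.of_comp (f := Θ) hinj
  · have := ker_le_of_conj_mem hD hgen (fun i c => γ ⟨i, c⟩) (Φ.range.map q.ker.subtype)
      (fun i c a ha => ⟨_, ⟨(D.cover q).vertHom T ⟨i, c⟩ (⟨a, ha⟩ : ↥(D.U i ⊓ q.ker)), rfl⟩,
        hΦv' ⟨i, c⟩ ⟨a, ha⟩⟩)
      (fun j d => ⟨_, ⟨(D.cover q).edgeElt T ⟨j, d⟩, rfl⟩, hΦe' ⟨j, d⟩⟩)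
    intro k
    obtain ⟨_, ⟨x, rfl⟩, hx⟩ := this k.2
    exact ⟨x, Subtype.ext hx⟩

end SubgroupGraph

/-! ### Standard subgroups of right-angled Artin groups -/

section RAAG

variable {V : Type*} (Γ : SimpleGraph V)

/-- The subgroup generated by the vertices in `C`. It is the image of the right-angled Artin group of
the full subgraph on `C`. -/
def vertexSubgroup (C : Set V) : Subgroup (RAAG Γ) :=
  Subgroup.closure ((PresentedGroup.of : V → RAAG Γ) '' C)

variable {Γ}

theorem of_mem_vertexSubgroup {C : Set V} {v : V} (hv : v ∈ C) :
    (PresentedGroup.of v : RAAG Γ) ∈ vertexSubgroup Γ C :=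
  Subgroup.subset_closure ⟨v, hv, rfl⟩

theorem vertexSubgroup_mono {A B : Set V} (h : A ⊆ B) :
    vertexSubgroup Γ A ≤ vertexSubgroup Γ B :=
  Subgroup.closure_mono (Set.image_mono h)

theorem vertexSubgroup_univ : vertexSubgroup Γ Set.univ = ⊤ := by
  rw [vertexSubgroup, Set.image_univ, PresentedGroup.closure_range_of]

theorem vertexSubgroup_union (A B : Set V) :
    vertexSubgroup Γ (A ∪ B) = vertexSubgroup Γ A ⊔ vertexSubgroup Γ B := by
  rw [vertexSubgroup, Set.image_union, Subgroup.closure_union, vertexSubgroup, vertexSubgroup]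

theorem of_mul_of {x y : V} (h : Γ.Adj x y) :
    (PresentedGroup.of x : RAAG Γ) * PresentedGroup.of y =
      PresentedGroup.of y * PresentedGroup.of x := by
  have : PresentedGroup.mk (raagRels Γ) (FreeGroup.of x * FreeGroup.of y *
      (FreeGroup.of x)⁻¹ * (FreeGroup.of y)⁻¹) = 1 :=
    PresentedGroup.one_of_mem ⟨x, y, h, rfl⟩
  simp only [map_mul, map_inv] at this
  rwa [mul_inv_eq_one, mul_inv_eq_iff_eq_mul] at this

theorem exists_raagHom {H : Type*} [Group H] (φ : V → H)
    (h : ∀ x y, Γ.Adj x y → φ x * φ y = φ y * φ x) :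
    ∃ Φ : RAAG Γ →* H, ∀ v, Φ (PresentedGroup.of v) = φ v := by
  refine ⟨PresentedGroup.toGroup (f := φ) ?_, fun v => PresentedGroup.toGroup.of _⟩
  rintro _ ⟨x, y, hxy, rfl⟩
  simp only [map_mul, map_inv, FreeGroup.lift_apply_of]
  rw [h x y hxy, mul_inv_cancel_right, mul_inv_cancel]

theorem eqOn_vertexSubgroup {H : Type*} [Group H] {Φ Ψ : RAAG Γ →* H} {C : Set V}
    (h : ∀ v ∈ C, Φ (PresentedGroup.of v) = Ψ (PresentedGroup.of v)) {g : RAAG Γ}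
    (hg : g ∈ vertexSubgroup Γ C) : Φ g = Ψ g := by
  refine MonoidHom.eqOn_closure (s := (PresentedGroup.of : V → RAAG Γ) '' C) ?_ hg
  rintro _ ⟨v, hv, rfl⟩
  exact h v hv

theorem inclusion_of (C : Set V) (v : C) :
    RAAG.inclusion Γ C (PresentedGroup.of v) = PresentedGroup.of (v : V) :=
  PresentedGroup.toGroup.of _

theorem range_inclusion (C : Set V) : (RAAG.inclusion Γ C).range = vertexSubgroup Γ C := by
  rw [MonoidHom.range_eq_map, ← PresentedGroup.closure_range_of, MonoidHom.map_closure,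
    vertexSubgroup]
  congr 1
  ext g
  simp only [Set.mem_image, Set.mem_range]
  constructor
  · rintro ⟨_, ⟨v, rfl⟩, rfl⟩
    exact ⟨v, v.2, (inclusion_of C v).symm⟩
  · rintro ⟨v, hv, rfl⟩
    exact ⟨_, ⟨⟨v, hv⟩, rfl⟩, inclusion_of C _⟩

/-- The inclusion has a retraction, which kills the vertices outside `C`. -/
theorem inclusion_injective (C : Set V) : Function.Injective (RAAG.inclusion Γ C) := by
  classical
  obtain ⟨r, hr⟩ := exists_raagHom (Γ := Γ) (H := RAAG (Γ.induce C))
    (fun v => if h : v ∈ C then PresentedGroup.of ⟨v, h⟩ else 1) (by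
      intro x y hxy
      by_cases hx : x ∈ C
      · by_cases hy : y ∈ C
        · simp only [dif_pos hx, dif_pos hy]
          exact of_mul_of (Γ := Γ.induce C) (x := ⟨x, hx⟩) (y := ⟨y, hy⟩) hxy
        · simp [dif_neg hy]
      · simp [dif_neg hx])
  refine Function.LeftInverse.injective (g := r) fun g => ?_
  have : r.comp (RAAG.inclusion Γ C) = MonoidHom.id _ := by
    refine PresentedGroup.ext fun v => ?_
    simp [inclusion_of, hr]
  exact DFunLike.congr_fun this g

theorem nonempty_ker_restrict_equiv (f : RAAG Γ →* Multiplicative ℝ) (C : Set V) :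
    Nonempty (↥(vertexSubgroup Γ C ⊓ f.ker) ≃* (restrict f C).ker) := by
  let e := MonoidHom.ofInjective (inclusion_injective (Γ := Γ) C)
  have h : ((restrict f C).ker).map (RAAG.inclusion Γ C) = vertexSubgroup Γ C ⊓ f.ker := by
    rw [restrict, ← MonoidHom.comap_ker, Subgroup.map_comap_eq, range_inclusion]
  exact ⟨((Subgroup.equivMapOfInjective _ _ (inclusion_injective C)).trans
    (MulEquiv.subgroupCongr h)).symm⟩

theorem imageIndex_eq (f : RAAG Γ →* Multiplicative ℝ) {Q : Type*} [Group Q] (q : RAAG Γ →* Q)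
    (hq : Function.Surjective q) (hker : q.ker = f.ker) (C : Set V) :
    imageIndex f C = ((vertexSubgroup Γ C).map q).index := by
  rw [imageIndex, restrict, MonoidHom.range_comp, range_inclusion, ← Subgroup.index_comap,
    Subgroup.comap_map_eq, ← Subgroup.index_comap_of_surjective _ hq, Subgroup.comap_map_eq, hker]

theorem vertexSubgroup_comm {C : Set V} (hC : Γ.IsClique C) :
    ∀ a ∈ vertexSubgroup Γ C, ∀ b ∈ vertexSubgroup Γ C, a * b = b * a := by
  have h : ∀ x ∈ (PresentedGroup.of : V → RAAG Γ) '' C,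
      ∀ y ∈ (PresentedGroup.of : V → RAAG Γ) '' C, x * y = y * x := by
    rintro _ ⟨x, hx, rfl⟩ _ ⟨y, hy, rfl⟩
    by_cases hxy : x = y
    · rw [hxy]
    · exact of_mul_of (hC hx hy hxy)
  intro a ha b hb
  exact Subgroup.closure_induction₂ (p := fun a b _ _ => a * b = b * a) (fun x y hx hy => h x hx y hy)
    (by simp) (by simp) (fun x y z _ _ _ h1 h2 => (Commute.mul_left h1 h2))
    (fun x y z _ _ _ h1 h2 => (Commute.mul_right h1 h2))
    (fun x y _ _ h1 => Commute.inv_left h1) (fun x y _ _ h1 => Commute.inv_right h1) ha hb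

/-- The subgroup of a clique embeds in `ℤ ^ V`, whose subgroups are free of finite rank. -/
theorem isFGFreeAbelian_of_le [Finite V] {C : Set V} (hC : Γ.IsClique C) {K : Subgroup (RAAG Γ)}
    (hK : K ≤ vertexSubgroup Γ C) : IsFGFreeAbelian K := by
  classical
  have := Fintype.ofFinite V
  obtain ⟨ab, hab⟩ := exists_raagHom (Γ := Γ) (H := Multiplicative (V → ℤ))
    (fun v => Multiplicative.ofAdd (Pi.single v 1)) (fun _ _ _ => mul_comm _ _)
  -- On the subgroup of a clique, the abelianization `ab` has a left inverse `s`.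
  let _ : CommGroup (vertexSubgroup Γ C) :=
    { (inferInstance : Group (vertexSubgroup Γ C)) with
      mul_comm := fun a b => Subtype.ext (vertexSubgroup_comm hC a a.2 b b.2) }
  let s : Multiplicative (V → ℤ) →* vertexSubgroup Γ C :=
    { toFun := fun x => ∏ v, (if h : v ∈ C then
        (⟨PresentedGroup.of v, of_mem_vertexSubgroup h⟩ : vertexSubgroup Γ C) else 1) ^ (x.toAdd v)
      map_one' := by simp
      map_mul' := fun x y => by
        simp only [toAdd_mul, Pi.add_apply, zpow_add, Finset.prod_mul_distrib] }
  have hs : ∀ g ∈ vertexSubgroup Γ C, ((s (ab g) : vertexSubgroup Γ C) : RAAG Γ) = g := by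
    intro g hg
    refine eqOn_vertexSubgroup (Φ := (Subgroup.subtype _).comp (s.comp ab))
      (Ψ := MonoidHom.id _) (fun v hv => ?_) hg
    change ((s (ab (PresentedGroup.of v)) : vertexSubgroup Γ C) : RAAG Γ) = _
    rw [hab]
    have : s (Multiplicative.ofAdd (Pi.single v 1)) =
        ⟨PresentedGroup.of v, of_mem_vertexSubgroup hv⟩ := by
      change ∏ w, _ = _
      rw [Finset.prod_eq_single v]
      · simp [hv]
      · intro w _ hw
        simp [hw]
      · simp
    rw [this]
    rfl
  have hinj : Function.Injective (ab.comp K.subtype) := by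
    intro a b h
    have h' : ab a = ab b := h
    refine Subtype.ext ?_
    rw [← hs a (hK a.2), ← hs b (hK b.2), h']
  let N : AddSubgroup (V → ℤ) := Subgroup.toAddSubgroup' ((ab.comp K.subtype).range)
  obtain ⟨n, b⟩ := Submodule.basisOfPid (Pi.basisFun ℤ V) (AddSubgroup.toIntSubmodule N)
  refine ⟨n, ⟨(MonoidHom.ofInjective hinj).trans ?_⟩⟩
  let e : N ≃+ (Fin n → ℤ) := b.equivFun.toAddEquiv
  exact
    { toFun := fun x => Multiplicative.ofAdd (e ⟨x.1.toAdd, x.2⟩)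
      invFun := fun y => ⟨Multiplicative.ofAdd (e.symm y.toAdd).1, (e.symm y.toAdd).2⟩
      left_inv := fun x => by simp
      right_inv := fun y => by simp
      map_mul' := fun x y => congrArg Multiplicative.ofAdd (e.map_add _ _) }

end RAAG

section Gluing

variable {Q : Type*} [CommGroup Q] (H : Type*) [Group H]

/-- The action of `Q` on functions on `Q` by translation. -/
def shift : Q →* MulAut (Q → H) where
  toFun m :=
    { toFun := fun F n => F (m⁻¹ * n)
      invFun := fun F n => F (m * n)
      left_inv := fun F => by simp
      right_inv := fun F => by simp
      map_mul' := fun _ _ => rfl }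
  map_one' := by ext; simp
  map_mul' m m' := by
    ext F n
    change F _ = F _
    rw [mul_inv, mul_comm m⁻¹, mul_assoc]

theorem shift_apply (m : Q) (F : Q → H) (n : Q) : shift H m F n = F (m⁻¹ * n) := rfl

variable {H} in
/-- A cocycle on `M` is the same as a homomorphism over `Q` from `M` to the unrestricted wreath product
of `H` by `Q`. The function part is indexed by the target of an arrow, not by its source. -/
def IsCocycleOn.toHom {G : Type*} [Group G] {q : G →* Q} {M : Subgroup G} {F : G → Q → H}
    (hF : IsCocycleOn q M F) : M →* (Q → H) ⋊[shift H] Q :=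
  MonoidHom.mk' (fun g => ⟨fun n => F g (q (g : G)⁻¹ * n), q g⟩) (by
    intro g g'
    refine SemidirectProduct.ext ?_ ?_
    · funext n
      change F (g * g') (q (g * g' : G)⁻¹ * n) = F g _ * F g' (q (g' : G)⁻¹ * ((q g)⁻¹ * n))
      rw [hF g g.2 g' g'.2]
      simp [mul_assoc]
    · simp)

variable {V : Type u} {Γ : SimpleGraph V}

/-- Cocycles are homomorphisms to a wreath product, and the latter can be defined vertex by vertex,
since every edge inside `A ∪ B` lies in `A` or in `B`. -/
theorem hasGluing_vertexSubgroup {Q : Type u} [CommGroup Q] (q : RAAG Γ →* Q) {A B : Set V}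
    (hAB : ∀ x ∈ A ∪ B, ∀ y ∈ A ∪ B, Γ.Adj x y → (x ∈ A ∧ y ∈ A) ∨ (x ∈ B ∧ y ∈ B)) :
    SubgroupGraph.HasGluing q (vertexSubgroup Γ A) (vertexSubgroup Γ B)
      (vertexSubgroup Γ (A ∩ B)) (vertexSubgroup Γ (A ∪ B)) := by
  classical
  intro H _ F₁ F₂ hF₁ hF₂ hS
  let φ : V → (Q → H) ⋊[shift H] Q := fun v =>
    if h : v ∈ A then hF₁.toHom ⟨_, of_mem_vertexSubgroup h⟩
    else if h : v ∈ B then hF₂.toHom ⟨_, of_mem_vertexSubgroup h⟩ else 1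
  have hφA : ∀ v (h : v ∈ A), φ v = hF₁.toHom ⟨_, of_mem_vertexSubgroup h⟩ := fun v h => by
    simp only [φ, dif_pos h]
  have hφB : ∀ v (h : v ∈ B), φ v = hF₂.toHom ⟨_, of_mem_vertexSubgroup h⟩ := fun v h => by
    by_cases hA : v ∈ A
    · rw [hφA v hA]
      refine SemidirectProduct.ext ?_ rfl
      funext n
      exact hS _ (of_mem_vertexSubgroup ⟨hA, h⟩) _
    · simp only [φ, dif_neg hA, dif_pos h]
  have hφ : ∀ v, v ∉ A ∪ B → φ v = 1 := fun v h => by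
    simp only [φ, dif_neg (fun h' => h (Or.inl h')), dif_neg (fun h' => h (Or.inr h'))]
  obtain ⟨Ψ, hΨ⟩ := exists_raagHom (Γ := Γ) φ (by
    intro x y hxy
    by_cases hx : x ∈ A ∪ B
    · by_cases hy : y ∈ A ∪ B
      · rcases hAB x hx y hy hxy with ⟨h1, h2⟩ | ⟨h1, h2⟩
        · rw [hφA x h1, hφA y h2, ← map_mul, ← map_mul]
          exact congrArg _ (Subtype.ext (of_mul_of hxy))
        · rw [hφB x h1, hφB y h2, ← map_mul, ← map_mul]
          exact congrArg _ (Subtype.ext (of_mul_of hxy))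
      · rw [hφ y hy, mul_one, one_mul]
    · rw [hφ x hx, mul_one, one_mul])
  have hext : ∀ (C : Set V) (F : RAAG Γ → Q → H) (hF : IsCocycleOn q (vertexSubgroup Γ C) F),
      (∀ v (h : v ∈ C), φ v = hF.toHom ⟨_, of_mem_vertexSubgroup h⟩) →
      ∀ g (hg : g ∈ vertexSubgroup Γ C), Ψ g = hF.toHom ⟨g, hg⟩ := by
    intro C F hF h g hg
    induction hg using Subgroup.closure_induction with
    | mem x hx =>
      obtain ⟨v, hv, rfl⟩ := hx
      rw [hΨ, h v hv]
    | one => rw [map_one]; exact (map_one hF.toHom).symm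
    | mul x y hx hy ihx ihy =>
      rw [map_mul, ihx, ihy, ← map_mul]
      rfl
    | inv x hx ihx =>
      rw [map_inv, ihx, ← map_inv]
      rfl
  have hΨA := hext A F₁ hF₁ hφA
  have hΨB := hext B F₂ hF₂ hφB
  have hright : ∀ g ∈ vertexSubgroup Γ (A ∪ B), (Ψ g).right = q g := by
    intro g hg
    refine eqOn_vertexSubgroup (Φ := SemidirectProduct.rightHom.comp Ψ) (Ψ := q) ?_ hg
    rintro v (hv | hv)
    · change (Ψ _).right = _
      rw [hΨA _ (of_mem_vertexSubgroup hv)]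
      rfl
    · change (Ψ _).right = _
      rw [hΨB _ (of_mem_vertexSubgroup hv)]
      rfl
  refine ⟨fun g n => (Ψ g).left (q g * n), ?_, ?_, ?_⟩
  · intro g hg g' hg' n
    simp only [map_mul, SemidirectProduct.mul_left, Pi.mul_apply, hright g hg, shift_apply,
      mul_assoc, inv_mul_cancel_left]
  · intro g hg
    funext n
    change (Ψ g).left _ = _
    rw [hΨA g hg]
    change F₁ g (q g⁻¹ * (q g * n)) = _
    rw [map_inv, inv_mul_cancel_left]
  · intro g hg
    funext n
    change (Ψ g).left _ = _
    rw [hΨB g hg]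
    change F₂ g (q g⁻¹ * (q g * n)) = _
    rw [map_inv, inv_mul_cancel_left]

end Gluing

/-! ### Minimal separators of chordal graphs -/

section Separators

open SimpleGraph

variable {V : Type*} {Γ : SimpleGraph V}

theorem induce_preconnected_iff {D : Set V} : (Γ.induce D).Preconnected ↔
    ∀ x ∈ D, ∀ y ∈ D, ∃ p : Γ.Walk x y, ∀ w ∈ p.support, w ∈ D := by
  constructor
  · intro h x hx y hy
    obtain ⟨p⟩ := h ⟨x, hx⟩ ⟨y, hy⟩
    refine ⟨p.map (Embedding.induce D).toHom, fun w hw => ?_⟩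
    obtain ⟨z, _, rfl⟩ := List.mem_map.1
      ((congrArg (w ∈ ·) (Walk.support_map (Embedding.induce D).toHom p)).mp hw)
    exact z.2
  · rintro h ⟨x, hx⟩ ⟨y, hy⟩
    obtain ⟨p, hp⟩ := h x hx y hy
    exact ⟨p.induce D hp⟩

/-- The vertices that can be reached from `x` by a walk inside `D`. For `x ∈ D` this is the connected
component of `x` in the full subgraph on `D`; for `x ∉ D` it is empty. -/
def component (Γ : SimpleGraph V) (D : Set V) (x : V) : Set V :=
  {v | ∃ p : Γ.Walk x v, ∀ w ∈ p.support, w ∈ D}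

theorem component_subset {D : Set V} {x : V} : component Γ D x ⊆ D := by
  rintro v ⟨p, hp⟩
  exact hp _ p.end_mem_support

theorem self_mem_component {D : Set V} {x : V} (hx : x ∈ D) : x ∈ component Γ D x :=
  ⟨Walk.nil, by simpa using hx⟩

theorem mem_component_of_adj {D : Set V} {x v w : V} (hv : v ∈ component Γ D x) (hw : w ∈ D)
    (h : Γ.Adj v w) : w ∈ component Γ D x := by
  obtain ⟨p, hp⟩ := hv
  refine ⟨p.concat h, fun z hz => ?_⟩
  rw [Walk.support_concat, List.mem_append, List.mem_singleton] at hz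
  rcases hz with hz | rfl
  exacts [hp z hz, hw]

theorem component_symm {D : Set V} {x y : V} (h : y ∈ component Γ D x) : x ∈ component Γ D y := by
  obtain ⟨p, hp⟩ := h
  exact ⟨p.reverse, fun w hw => hp w (by simpa using hw)⟩

theorem component_trans {D : Set V} {x y z : V} (h : y ∈ component Γ D x)
    (h' : z ∈ component Γ D y) : z ∈ component Γ D x := by
  obtain ⟨p, hp⟩ := h
  obtain ⟨p', hp'⟩ := h'
  refine ⟨p.append p', fun w hw => ?_⟩
  rcases (Walk.mem_support_append_iff _ _).1 hw with hw | hw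
  exacts [hp w hw, hp' w hw]

theorem exists_walk_component {D : Set V} {x a b : V} (ha : a ∈ component Γ D x)
    (hb : b ∈ component Γ D x) :
    ∃ p : Γ.Walk a b, ∀ w ∈ p.support, w ∈ component Γ D x := by
  classical
  obtain ⟨p, hp⟩ := component_trans (component_symm ha) hb
  exact ⟨p, fun w hw => component_trans ha
    ⟨p.takeUntil w hw, fun z hz => hp z (p.support_takeUntil_subset_support hw hz)⟩⟩

theorem exists_not_mem_component {D : Set V} (h : ¬ (Γ.induce D).Preconnected) :
    ∃ x ∈ D, ∃ y ∈ D, y ∉ component Γ D x := by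
  rw [induce_preconnected_iff] at h
  push Not at h
  obtain ⟨x, hx, y, hy, h⟩ := h
  refine ⟨x, hx, y, hy, ?_⟩
  rintro ⟨p, hp⟩
  obtain ⟨w, hw, hw'⟩ := h p
  exact hw' (hp w hw)

theorem not_preconnected_of_closed {D X : Set V} {x y : V} (hx : x ∈ D) (hy : y ∈ D) (hxX : x ∈ X)
    (hyX : y ∉ X) (hX : ∀ v ∈ X, ∀ w ∈ D, Γ.Adj v w → w ∈ X) : ¬ (Γ.induce D).Preconnected := by
  rw [induce_preconnected_iff]
  intro h
  obtain ⟨p, hp⟩ := h x hx y hy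
  obtain ⟨d, hd, h1, h2⟩ := p.exists_boundary_dart X hxX hyX
  exact h2 (hX _ h1 _ (hp _ (p.dart_snd_mem_support_of_mem_darts hd)) d.adj)

/-- If adding `s` to `D` connects `x` to a vertex of another component, then `s` has a neighbour in the
component of `x`. -/
theorem exists_adj_component {D : Set V} {x y s : V} (hx : x ∈ D) (hy : y ∉ component Γ D x)
    (p : Γ.Walk x y) (hp : ∀ w ∈ p.support, w ∈ insert s D) : ∃ a ∈ component Γ D x, Γ.Adj a s := by
  obtain ⟨d, hd, h1, h2⟩ := p.exists_boundary_dart _ (self_mem_component hx) hy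
  refine ⟨d.fst, h1, ?_⟩
  rcases hp _ (p.dart_snd_mem_support_of_mem_darts hd) with h | h
  · rw [← h]; exact d.adj
  · exact absurd (mem_component_of_adj h1 h d.adj) h2

theorem mem_edges_of_length_le_one {a b : V} (h : Γ.Adj a b) (M : Γ.Walk a b) (hM : M.length ≤ 1) :
    s(a, b) ∈ M.edges := by
  cases M with
  | nil => exact absurd h (Γ.irrefl)
  | cons h' M' =>
    have : M'.length = 0 := by
      rw [Walk.length_cons] at hM; omega
    have := Walk.eq_of_length_eq_zero this
    subst this
    simp

/-- A shortest walk inside `Z` is a path without chords. -/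
theorem exists_chordless_path {Z : Set V} {s t : V}
    (h : ∃ p : Γ.Walk s t, ∀ w ∈ p.support, w ∈ Z) :
    ∃ p : Γ.Walk s t, p.IsPath ∧ (∀ w ∈ p.support, w ∈ Z) ∧
      ∀ a ∈ p.support, ∀ b ∈ p.support, Γ.Adj a b → s(a, b) ∈ p.edges := by
  classical
  have hex : ∃ n, ∃ p : Γ.Walk s t, p.length = n ∧ ∀ w ∈ p.support, w ∈ Z := by
    obtain ⟨p, hp⟩ := h
    exact ⟨_, p, rfl, hp⟩
  obtain ⟨p, hpn, hp⟩ := Nat.find_spec hex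
  have hmin : ∀ p' : Γ.Walk s t, (∀ w ∈ p'.support, w ∈ Z) → p.length ≤ p'.length := by
    intro p' hp'
    rw [hpn]
    exact Nat.find_min' hex ⟨p', rfl, hp'⟩
  have hpath : p.IsPath := by
    rw [← Walk.bypass_eq_self_of_length_le_length_bypass p
      (hmin _ fun w hw => hp w (p.support_bypass_subset_support hw))]
    exact p.bypass_isPath
  have key : ∀ (a b : V) (A : Γ.Walk s a) (M : Γ.Walk a b) (B : Γ.Walk b t), Γ.Adj a b →
      p = A.append (M.append B) → s(a, b) ∈ p.edges := by
    rintro a b A M B hab rfl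
    have := hmin (A.append (Walk.cons hab B)) (by
      intro w hw
      apply hp w
      rw [Walk.mem_support_append_iff, Walk.support_cons, List.mem_cons] at hw
      simp only [Walk.mem_support_append_iff]
      rcases hw with hw | rfl | hw
      · exact Or.inl hw
      · exact Or.inl A.end_mem_support
      · exact Or.inr (Or.inr hw))
    simp only [Walk.length_append, Walk.length_cons] at this
    have := mem_edges_of_length_le_one hab M (by omega)
    simp only [Walk.edges_append, List.mem_append]
    exact Or.inr (Or.inl this)
  refine ⟨p, hpath, hp, fun a ha b hb hab => ?_⟩
  have hb' := hb
  rw [← p.take_spec ha, Walk.mem_support_append_iff] at hb'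
  rcases hb' with hb' | hb'
  · rw [Sym2.eq_swap]
    refine key b a ((p.takeUntil a ha).takeUntil b hb') ((p.takeUntil a ha).dropUntil b hb')
      (p.dropUntil a ha) hab.symm ?_
    rw [Walk.append_assoc, Walk.take_spec, Walk.take_spec]
  · refine key a b (p.takeUntil a ha) ((p.dropUntil a ha).takeUntil b hb')
      ((p.dropUntil a ha).dropUntil b hb') hab ?_
    rw [Walk.take_spec, Walk.take_spec]

theorem isCycle_append {s t : V} {p : Γ.Walk s t} {q : Γ.Walk t s} (hp : p.IsPath) (hq : q.IsPath)
    (hst : s ≠ t) (hadj : ¬ Γ.Adj s t)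
    (hpq : ∀ w ∈ p.support, w ∈ q.support → w = s ∨ w = t) : (p.append q).IsCycle := by
  have htail : ∀ {a b : V} (r : Γ.Walk a b), r.IsPath → a ∉ r.support.tail := by
    intro a b r hr
    have := hr.support_nodup
    rw [← r.cons_tail_support, List.nodup_cons] at this
    exact this.1
  rw [Walk.isCycle_def]
  refine ⟨⟨?_⟩, ?_, ?_⟩
  · rw [Walk.edges_append, List.nodup_append]
    refine ⟨hp.isTrail.edges_nodup, hq.isTrail.edges_nodup, ?_⟩
    rintro e he _ he' rfl
    induction e with
    | h a b =>
      have hab := p.adj_of_mem_edges he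
      have h1 := hpq a (p.fst_mem_support_of_mem_edges he) (q.fst_mem_support_of_mem_edges he')
      have h2 := hpq b (p.snd_mem_support_of_mem_edges he) (q.snd_mem_support_of_mem_edges he')
      rcases h1 with rfl | rfl <;> rcases h2 with rfl | rfl
      exacts [Γ.irrefl hab, hadj hab, hadj hab.symm, Γ.irrefl hab]
  · intro h
    have := congrArg Walk.length h
    rw [Walk.length_append, Walk.length_nil] at this
    exact hst (Walk.eq_of_length_eq_zero (p := p) (by omega))
  · rw [Walk.tail_support_append, List.nodup_append]
    refine ⟨hp.support_nodup.tail, hq.support_nodup.tail, ?_⟩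
    rintro w hw _ hw' rfl
    rcases hpq w (List.mem_of_mem_tail hw) (List.mem_of_mem_tail hw') with rfl | rfl
    exacts [htail p hp hw, htail q hq hw']

theorem two_le_length {s t : V} (hst : s ≠ t) (hadj : ¬ Γ.Adj s t) (p : Γ.Walk s t) :
    2 ≤ p.length := by
  cases p with
  | nil => exact absurd rfl hst
  | cons h p' =>
    cases p' with
    | nil => exact absurd h hadj
    | cons h' p'' => simp only [Walk.length_cons]; omega

/-- Dirac's theorem. By minimality, every vertex of `S` has neighbours in every component of the
complement. Two non-adjacent vertices of `S` could therefore be joined by chordless paths through two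
different components, and together these would form a chordless cycle of length at least four. -/
theorem isClique_of_minimal_isSeparating (hΓ : IsChordal Γ) {C S : Set V}
    (hS : Minimal (IsSeparating Γ C) S) : Γ.IsClique S := by
  intro s hs t ht hst
  by_contra hadj
  obtain ⟨x, hx, y, hy, hxy⟩ := exists_not_mem_component hS.prop.2
  set D := C \ S with hD
  have hyx : x ∉ component Γ D y := fun h => hxy (component_symm h)
  have hwalk : ∀ u ∈ S, ∃ p : Γ.Walk x y, ∀ w ∈ p.support, w ∈ insert u D := by
    intro u hu
    have hns : ¬ IsSeparating Γ C (S \ {u}) := fun h =>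
      (hS.le_of_le h Set.sdiff_subset hu).2 rfl
    have hpre : (Γ.induce (C \ (S \ {u}))).Preconnected := by
      by_contra h
      exact hns ⟨Set.sdiff_subset.trans hS.prop.1, h⟩
    have heq : C \ (S \ {u}) ⊆ insert u D := by
      rintro w ⟨hw, hw'⟩
      by_cases hwu : w = u
      · exact Or.inl hwu
      · exact Or.inr ⟨hw, fun h => hw' ⟨h, hwu⟩⟩
    obtain ⟨p, hp⟩ := induce_preconnected_iff.1 hpre x ⟨hx.1, fun h => hx.2 h.1⟩
      y ⟨hy.1, fun h => hy.2 h.1⟩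
    exact ⟨p, fun w hw => heq (hp w hw)⟩
  have hnbr : ∀ u ∈ S, (∃ a ∈ component Γ D x, Γ.Adj a u) ∧ ∃ a ∈ component Γ D y, Γ.Adj a u := by
    intro u hu
    obtain ⟨p, hp⟩ := hwalk u hu
    exact ⟨exists_adj_component hx hxy p hp,
      exists_adj_component hy hyx p.reverse fun w hw => hp w (by simpa using hw)⟩
  have hpath : ∀ z, (∃ a ∈ component Γ D z, Γ.Adj a s) → (∃ a ∈ component Γ D z, Γ.Adj a t) →
      ∃ p : Γ.Walk s t, p.IsPath ∧ (∀ w ∈ p.support, w ∈ insert s (insert t (component Γ D z))) ∧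
      ∀ a ∈ p.support, ∀ b ∈ p.support, Γ.Adj a b → s(a, b) ∈ p.edges := by
    rintro z ⟨a, ha, has⟩ ⟨b, hb, hbt⟩
    apply exists_chordless_path
    obtain ⟨p, hp⟩ := exists_walk_component ha hb
    refine ⟨Walk.cons has.symm (p.concat hbt), fun w hw => ?_⟩
    rw [Walk.support_cons, List.mem_cons, Walk.support_concat,
      List.mem_append, List.mem_singleton] at hw
    rcases hw with rfl | hw | rfl
    · exact Or.inl rfl
    · exact Or.inr (Or.inr (hp w hw))
    · exact Or.inr (Or.inl rfl)
  obtain ⟨p, hp, hpX, hpc⟩ := hpath x (hnbr s hs).1 (hnbr t ht).1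
  obtain ⟨q, hq, hqY, hqc⟩ := hpath y (hnbr s hs).2 (hnbr t ht).2
  -- the two components are disjoint and there is no edge between them
  have hdisj : ∀ w ∈ component Γ D x, w ∉ component Γ D y := fun w h h' =>
    hxy (component_trans h (component_symm h'))
  have hno : ∀ v ∈ component Γ D x, ∀ w ∈ component Γ D y, ¬ Γ.Adj v w := fun v hv w hw h =>
    hdisj w (mem_component_of_adj hv (component_subset hw) h) hw
  have hcyc : (p.append q.reverse).IsCycle := by
    refine isCycle_append hp hq.reverse hst hadj fun w hw hw' => ?_
    rw [Walk.support_reverse, List.mem_reverse] at hw'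
    rcases hpX w hw with h | h | h
    · exact Or.inl h
    · exact Or.inr h
    rcases hqY w hw' with h' | h' | h'
    · exact Or.inl h'
    · exact Or.inr h'
    · exact absurd h' (hdisj w h)
  obtain ⟨a, ha, b, hb, hab, hE⟩ := hΓ s _ hcyc (by
    rw [Walk.length_append, Walk.length_reverse]
    have := two_le_length hst hadj p
    have := two_le_length hst hadj q
    omega)
  rw [Walk.edges_append, Walk.edges_reverse, List.mem_append, List.mem_reverse, not_or] at hE
  rw [Walk.mem_support_append_iff, Walk.support_reverse, List.mem_reverse] at ha hb
  have hsp := p.start_mem_support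
  have htp := p.end_mem_support
  have hsq := q.start_mem_support
  have htq := q.end_mem_support
  have hcross : ∀ a ∈ p.support, ∀ b ∈ q.support, Γ.Adj a b → s(a, b) ∉ p.edges →
      s(a, b) ∉ q.edges → False := by
    intro a ha b hb hab h1 h2
    rcases hpX a ha with rfl | rfl | haX
    · exact h2 (hqc _ hsq _ hb hab)
    · exact h2 (hqc _ htq _ hb hab)
    rcases hqY b hb with rfl | rfl | hbY
    · exact h1 (hpc _ ha _ hsp hab)
    · exact h1 (hpc _ ha _ htp hab)
    exact hno a haX b hbY hab
  rcases ha with ha | ha <;> rcases hb with hb | hb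
  · exact hE.1 (hpc a ha b hb hab)
  · exact hcross a ha b hb hab hE.1 hE.2
  · rw [Sym2.eq_swap] at hE
    exact hcross b hb a ha hab.symm hE.1 hE.2
  · exact hE.2 (hqc a ha b hb hab)

theorem exists_minimal_isSeparating [Finite V] {C : Set V} (hC : ¬ Γ.IsClique C) :
    ∃ S, Minimal (IsSeparating Γ C) S := by
  rw [isClique_iff, Set.Pairwise] at hC
  push Not at hC
  obtain ⟨x, hx, y, hy, hxy, hadj⟩ := hC
  obtain ⟨S, -, hS⟩ := exists_minimal_le_of_wellFoundedLT (IsSeparating Γ C) (C \ {x, y})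
    ⟨Set.sdiff_subset, not_preconnected_of_closed (X := {x}) (x := x) (y := y)
      ⟨hx, fun h => h.2 (Or.inl rfl)⟩ ⟨hy, fun h => h.2 (Or.inr rfl)⟩ rfl hxy.symm (by
        rintro v rfl w ⟨hw, hw'⟩ h
        by_contra hwv
        have : w = y := by
          by_contra hwy
          exact hw' ⟨hw, by rintro (h | h); exacts [hwv h, hwy h]⟩
        exact hadj (this ▸ h))⟩
  exact ⟨S, hS⟩

theorem exists_isSplitting {C S : Set V} (hS : IsSeparating Γ C S) (hne : S.Nonempty) :
    ∃ A B, A ∩ B = S ∧ IsSplitting Γ C A B ∧ A ⊂ C ∧ B ⊂ C := by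
  obtain ⟨x, hx, y, hy, hxy⟩ := exists_not_mem_component hS.2
  set X := component Γ (C \ S) x with hX
  have hxX : x ∈ X := self_mem_component hx
  have hXD : X ⊆ C \ S := component_subset
  have hinter : (X ∪ S) ∩ (C \ X) = S := by
    ext w
    constructor
    · rintro ⟨h | h, h'⟩
      exacts [absurd h h'.2, h]
    · intro h
      exact ⟨Or.inr h, hS.1 h, fun h' => (hXD h').2 h⟩
  have hunion : (X ∪ S) ∪ (C \ X) = C := by
    ext w
    constructor
    · rintro ((h | h) | h)
      exacts [(hXD h).1, hS.1 h, h.1]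
    · intro h
      by_cases hw : w ∈ X
      exacts [Or.inl (Or.inl hw), Or.inr ⟨h, hw⟩]
  have hxA : x ∈ X ∪ S := Or.inl hxX
  have hxB : x ∉ C \ X := fun h => h.2 hxX
  have hyA : y ∉ X ∪ S := by rintro (h | h); exacts [hxy h, hy.2 h]
  have hyB : y ∈ C \ X := ⟨hy.1, hxy⟩
  refine ⟨X ∪ S, C \ X, hinter, ⟨hunion, hinter.symm ▸ hne, ?_, ?_, ?_, ?_⟩, ?_, ?_⟩
  · intro h; exact hxB (h ▸ hxA)
  · intro h
    rw [h] at hxA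
    exact hxB hxA.2
  · intro h
    rw [h] at hyB
    exact hyA hyB.1
  · intro v hv w hw h
    by_cases h1 : v ∈ X
    · left
      refine ⟨Or.inl h1, ?_⟩
      by_cases h2 : w ∈ S
      · exact Or.inr h2
      · exact Or.inl (mem_component_of_adj h1 ⟨hw, h2⟩ h)
    · by_cases h2 : w ∈ X
      · left
        refine ⟨?_, Or.inl h2⟩
        by_cases h3 : v ∈ S
        · exact Or.inr h3
        · exact Or.inl (mem_component_of_adj h2 ⟨hv, h3⟩ h.symm)
      · exact Or.inr ⟨⟨hv, h1⟩, hw, h2⟩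
  · exact ⟨fun w h => hunion ▸ Or.inl h, fun h => hyA (h hy.1)⟩
  · exact ⟨Set.sdiff_subset, fun h => hxB (h hx.1)⟩

/-- A clique stays on one side of a separator, so a separator of a piece separates the whole. -/
theorem IsSeparating.of_isSplitting {C A B S : Set V} (hsplit : IsSplitting Γ C A B)
    (hclique : Γ.IsClique (A ∩ B)) (hS : IsSeparating Γ A S) : IsSeparating Γ C S := by
  obtain ⟨hAB, -, -, -, -, hE⟩ := hsplit
  have hAC : A ⊆ C := hAB ▸ Set.subset_union_left
  refine ⟨hS.1.trans hAC, ?_⟩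
  obtain ⟨x, hx, y, hy, hxy⟩ := exists_not_mem_component hS.2
  set X := component Γ (A \ S) x
  have hXA : X ⊆ A \ S := component_subset
  refine not_preconnected_of_closed (X := X ∪ {v | v ∈ C ∧ v ∉ A ∧ ∃ z ∈ X, z ∈ B}) (x := x) (y := y)
    ⟨hAC hx.1, hx.2⟩ ⟨hAC hy.1, hy.2⟩ (Or.inl (self_mem_component hx)) ?_ ?_
  · rintro (h | h)
    exacts [hxy h, h.2.1 hy.1]
  · rintro v (hv | ⟨hvC, hv, z, hz, hzB⟩) w ⟨hwC, hwS⟩ h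
    · by_cases hwA : w ∈ A
      · exact Or.inl (mem_component_of_adj hv ⟨hwA, hwS⟩ h)
      · rcases hE v (hAC (hXA hv).1) w hwC h with h' | h'
        · exact absurd h'.2 hwA
        · exact Or.inr ⟨hwC, hwA, v, hv, h'.1⟩
    · by_cases hwA : w ∈ A
      · left
        by_cases hzw : z = w
        · exact hzw ▸ hz
        · rcases hE v hvC w hwC h with h' | h'
          · exact absurd h'.1 hv
          · exact mem_component_of_adj hz ⟨hwA, hwS⟩ (hclique ⟨(hXA hz).1, hzB⟩ ⟨hwA, h'.2⟩ hzw)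
      · exact Or.inr ⟨hwC, hwA, z, hz, hzB⟩

theorem IsSplitting.symm {C A B : Set V} (h : IsSplitting Γ C A B) : IsSplitting Γ C B A := by
  obtain ⟨h1, h2, h3, h4, h5, h6⟩ := h
  rw [Set.inter_comm] at h2 h4 h5
  exact ⟨Set.union_comm A B ▸ h1, h2, h3.symm, h5, h4, fun x hx y hy h => (h6 x hx y hy h).symm⟩

theorem IsSplitting.subset_or_subset {C A B K : Set V} (h : IsSplitting Γ C A B) (hK : Γ.IsClique K)
    (hKC : K ⊆ C) : K ⊆ A ∨ K ⊆ B := by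
  by_contra hcon
  rw [not_or, Set.not_subset, Set.not_subset] at hcon
  obtain ⟨⟨x, hx, hxA⟩, y, hy, hyB⟩ := hcon
  obtain ⟨h1, -, -, -, -, h6⟩ := h
  have hxB : x ∈ B := by
    have := hKC hx
    rw [← h1] at this
    exact this.resolve_left hxA
  have hxy : x ≠ y := fun h => hyB (h ▸ hxB)
  rcases h6 x (hKC hx) y (hKC hy) (hK hx hy hxy) with h' | h'
  exacts [hxA h'.1, hyB h'.2]

end Separators

/-! ### Wild kernels -/

section Wild

/-- The action of `ℤ` on the free group on `ℤ` by translation of the generators. -/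
def freeShift : Multiplicative ℤ →* MulAut (FreeGroup ℤ) where
  toFun m := FreeGroup.freeGroupCongr (Equiv.addLeft m.toAdd)
  map_one' := by
    ext x
    change FreeGroup.map _ x = x
    have : ((Equiv.addLeft (Multiplicative.toAdd (1 : Multiplicative ℤ))) : ℤ → ℤ) = id := by
      ext; simp
    rw [this, FreeGroup.map.id]
  map_mul' m m' := by
    ext x
    change FreeGroup.map _ x = FreeGroup.map _ (FreeGroup.map _ x)
    rw [FreeGroup.map.comp]
    congr 2
    ext n
    simp

theorem freeShift_of (m : Multiplicative ℤ) (j : ℤ) :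
    freeShift m (FreeGroup.of j) = FreeGroup.of (m.toAdd + j) := rfl

/-- A homomorphism over `ℤ` from `G` to `FreeGroup ℤ ⋊ ℤ` restricts to one from `q.ker` to the free
group. Conjugating `z` by the powers of `t` produces the elements `x₀` or `x₀ x_N⁻¹` translated by
`2 N k`; after killing all generators except `x_{2Nk}`, `k ∈ ℕ`, they become a free basis. -/
theorem isWild_ker_of_semidirect {G : Type*} [Group G] {q : G →* Multiplicative ℤ}
    (Ψ : G →* FreeGroup ℤ ⋊[freeShift] Multiplicative ℤ) (hΨ : ∀ g, (Ψ g).right = q g)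
    {t z : G} {N : ℤ} (hN : N ≠ 0) (ht : Ψ t = SemidirectProduct.inr (Multiplicative.ofAdd N))
    (hz : q z = 1)
    (hzl : (Ψ z).left = FreeGroup.of 0 ∨
      (Ψ z).left = FreeGroup.of 0 * (FreeGroup.of N)⁻¹) : IsWild q.ker := by
  classical
  let κ : FreeGroup ℤ →* FreeGroup ℕ :=
    FreeGroup.lift fun j => if h : ∃ k : ℕ, j = 2 * N * k then FreeGroup.of h.choose else 1
  have hκ : ∀ k : ℕ, κ (FreeGroup.of (2 * N * k)) = FreeGroup.of k := by
    intro k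
    have h : ∃ k' : ℕ, 2 * N * (k : ℤ) = 2 * N * k' := ⟨k, rfl⟩
    have h' : h.choose = k := by
      have := mul_left_cancel₀ (mul_ne_zero two_ne_zero hN) h.choose_spec
      exact_mod_cast this.symm
    simp only [κ, FreeGroup.lift_apply_of, dif_pos h, h']
  have hκ' : ∀ k : ℕ, κ (FreeGroup.of (2 * N * k + N)) = 1 := by
    intro k
    have h : ¬ ∃ k' : ℕ, 2 * N * (k : ℤ) + N = 2 * N * k' := by
      rintro ⟨k', h⟩
      have h2 : N * (2 * k + 1) = N * (2 * k') := by linarith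
      have := mul_left_cancel₀ hN h2
      omega
    simp only [κ, FreeGroup.lift_apply_of, dif_neg h]
  have hright : ∀ k : q.ker, (Ψ k).right = 1 := fun k => (hΨ k).trans k.2
  let Φ : q.ker →* FreeGroup ℕ := MonoidHom.mk' (fun k => κ (Ψ k).left) (by
    intro k k'
    simp [hright])
  refine ⟨Φ, ?_⟩
  rw [← MonoidHom.range_eq_top, eq_top_iff, ← FreeGroup.closure_range_of, Subgroup.closure_le]
  rintro _ ⟨k, rfl⟩
  have hmem : t ^ (2 * k) * z * (t ^ (2 * k))⁻¹ ∈ q.ker :=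
    (inferInstance : q.ker.Normal).conj_mem z hz _
  refine ⟨⟨_, hmem⟩, ?_⟩
  change κ (Ψ (t ^ (2 * k) * z * (t ^ (2 * k))⁻¹)).left = _
  have hzr : Ψ z = SemidirectProduct.inl (Ψ z).left :=
    SemidirectProduct.ext rfl ((hΨ z).trans hz)
  have hpow : Multiplicative.toAdd (Multiplicative.ofAdd N ^ (2 * k)) = 2 * N * k := by
    rw [toAdd_pow, toAdd_ofAdd, nsmul_eq_mul]
    push_cast
    ring
  rw [map_mul, map_mul, map_inv, map_pow, ht, hzr, ← map_pow, ← map_inv,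
    ← SemidirectProduct.inl_aut, SemidirectProduct.left_inl]
  rcases hzl with h | h
  · rw [h, freeShift_of, hpow, add_zero, hκ]
  · rw [h, map_mul, map_inv, freeShift_of, freeShift_of, hpow, add_zero, map_mul, map_inv, hκ,
      hκ', inv_one, mul_one]

variable {V : Type*} {Γ : SimpleGraph V}

/-- Vertices in `X` are sent to the factor `ℤ`. Vertices in `Y` are sent to the conjugate of this factor
by the generator `x₀`, or to `x₀` itself if `q` is trivial on `Y`. The two families need not commute,
since no edge joins `X` to `Y`. -/
theorem isWild_ker_of_disjoint {q : RAAG Γ →* Multiplicative ℤ} {X Y : Set V}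
    (hXY : Disjoint X Y) (hno : ∀ x ∈ X, ∀ y ∈ Y, ¬ Γ.Adj x y)
    (hdead : ∀ v, v ∉ X ∪ Y → q (PresentedGroup.of v) = 1) {v w : V} (hv : v ∈ X) (hw : w ∈ Y)
    (hqv : q (PresentedGroup.of v) ≠ 1) : IsWild q.ker := by
  classical
  have hYX : ∀ y ∈ Y, y ∉ X := fun y hy hx => Set.disjoint_left.1 hXY hx hy
  have key : ∀ ψ : V → FreeGroup ℤ ⋊[freeShift] Multiplicative ℤ,
      (∀ y ∈ Y, (ψ y).right = q (PresentedGroup.of y)) →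
      (∀ y y', ψ y * ψ y' = ψ y' * ψ y) →
      ∃ Ψ : RAAG Γ →* FreeGroup ℤ ⋊[freeShift] Multiplicative ℤ, (∀ g, (Ψ g).right = q g) ∧
        (∀ x ∈ X, Ψ (PresentedGroup.of x) = SemidirectProduct.inr (q (PresentedGroup.of x))) ∧
        ∀ y ∈ Y, Ψ (PresentedGroup.of y) = ψ y := by
    intro ψ hψ hcomm
    obtain ⟨Ψ, hΨ⟩ := exists_raagHom (Γ := Γ) (fun u => if u ∈ X then
      SemidirectProduct.inr (φ := freeShift) (q (PresentedGroup.of u)) else if u ∈ Y then ψ u else 1) (by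
      intro x y hxy
      by_cases hx : x ∈ X <;> by_cases hy : y ∈ X
      · simp only [if_pos hx, if_pos hy, ← map_mul, mul_comm]
      · by_cases hy' : y ∈ Y
        · exact absurd hxy (hno x hx y hy')
        · simp only [if_neg hy, if_neg hy', mul_one, one_mul]
      · by_cases hx' : x ∈ Y
        · exact absurd hxy.symm (hno y hy x hx')
        · simp only [if_neg hx, if_neg hx', mul_one, one_mul]
      · simp only [if_neg hx, if_neg hy]
        by_cases hx' : x ∈ Y <;> by_cases hy' : y ∈ Y <;> simp [hx', hy', hcomm x y])
    have hΨX : ∀ x ∈ X, Ψ (PresentedGroup.of x) =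
        SemidirectProduct.inr (q (PresentedGroup.of x)) := fun x hx => by
      rw [hΨ, if_pos hx]
    have hΨY : ∀ y ∈ Y, Ψ (PresentedGroup.of y) = ψ y := fun y hy => by
      rw [hΨ, if_neg (hYX y hy), if_pos hy]
    refine ⟨Ψ, ?_, hΨX, hΨY⟩
    have : SemidirectProduct.rightHom.comp Ψ = q := by
      refine PresentedGroup.ext fun u => ?_
      change (Ψ (PresentedGroup.of u)).right = _
      by_cases hu : u ∈ X
      · rw [hΨX u hu, SemidirectProduct.right_inr]
      · by_cases hu' : u ∈ Y
        · rw [hΨY u hu', hψ u hu']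
        · rw [hΨ, if_neg hu, if_neg hu', hdead u (by rintro (h | h); exacts [hu h, hu' h])]
          rfl
    exact fun g => DFunLike.congr_fun this g
  have hp : (q (PresentedGroup.of v)).toAdd ≠ 0 := fun h => hqv (toAdd_eq_zero.1 h)
  by_cases hY : ∀ y ∈ Y, q (PresentedGroup.of y) = 1
  · obtain ⟨Ψ, hΨ, hΨX, hΨY⟩ := key (fun _ => SemidirectProduct.inl (FreeGroup.of 0))
      (fun y hy => (hY y hy).symm) (fun _ _ => rfl)
    exact isWild_ker_of_semidirect Ψ hΨ hp (hΨX v hv) (hY w hw) (Or.inl (by rw [hΨY w hw]; rfl))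
  · push Not at hY
    obtain ⟨w, hw, hqw⟩ := hY
    have hr : (q (PresentedGroup.of w)).toAdd ≠ 0 := fun h => hqw (toAdd_eq_zero.1 h)
    obtain ⟨Ψ, hΨ, hΨX, hΨY⟩ := key (fun y => SemidirectProduct.inl (FreeGroup.of 0) *
        SemidirectProduct.inr (q (PresentedGroup.of y)) *
        (SemidirectProduct.inl (FreeGroup.of 0))⁻¹)
      (fun y _ => by simp) (fun y y' => by
        rw [conj_mul, conj_mul,
          ((Commute.all _ _).map (SemidirectProduct.inr (φ := freeShift))).eq])
    set a := q (PresentedGroup.of v) with ha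
    set b := q (PresentedGroup.of w) with hb
    have hav : a ^ b.toAdd = Multiplicative.ofAdd (a.toAdd * b.toAdd) := by
      apply Multiplicative.toAdd.injective
      rw [toAdd_zpow, toAdd_ofAdd, smul_eq_mul, mul_comm]
    have hbw : b ^ a.toAdd = Multiplicative.ofAdd (a.toAdd * b.toAdd) := by
      apply Multiplicative.toAdd.injective
      rw [toAdd_zpow, toAdd_ofAdd, smul_eq_mul]
    refine isWild_ker_of_semidirect Ψ hΨ (t := PresentedGroup.of v ^ b.toAdd)
      (z := PresentedGroup.of w ^ a.toAdd * (PresentedGroup.of v ^ b.toAdd)⁻¹)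
      (mul_ne_zero hp hr) ?_ ?_ (Or.inr ?_)
    · rw [map_zpow, hΨX v hv, ← map_zpow, hav]
    · rw [map_mul, map_inv, map_zpow, map_zpow, ← ha, ← hb, hav, hbw, mul_inv_cancel]
    · have hcomm : ∀ (x : FreeGroup ℤ) (n : Multiplicative ℤ),
          SemidirectProduct.inl (φ := freeShift) x * SemidirectProduct.inr n *
            (SemidirectProduct.inl x)⁻¹ * (SemidirectProduct.inr n)⁻¹ =
          SemidirectProduct.inl (x * freeShift n x⁻¹) := by
        intro x n
        rw [map_mul SemidirectProduct.inl, SemidirectProduct.inl_aut]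
        simp [mul_assoc]
      have hinr := map_zpow (SemidirectProduct.inr (φ := freeShift))
      rw [map_mul, map_inv, map_zpow, map_zpow, hΨX v hv, hΨY w hw, conj_zpow, ← hinr, ← hinr,
        ← ha, ← hb, hav, hbw, hcomm, SemidirectProduct.left_inl, map_inv, freeShift_of,
        toAdd_ofAdd, add_zero]

/-- If `q` is trivial on a separating set `S`, killing `S` turns the group into a free product. -/
theorem isWild_ker_of_isSeparating {q : RAAG Γ →* Multiplicative ℤ} (hq : q ≠ 1) {S : Set V}
    (hS : IsSeparating Γ Set.univ S) (hdead : ∀ v ∈ S, q (PresentedGroup.of v) = 1) :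
    IsWild q.ker := by
  obtain ⟨x, hx, y, hy, hxy⟩ := exists_not_mem_component hS.2
  set X := component Γ (Set.univ \ S) x
  have hxX : x ∈ X := self_mem_component hx
  have hXS : ∀ v ∈ X, v ∉ S := fun v hv => (component_subset hv).2
  let Y := {v | v ∉ X ∧ v ∉ S}
  have hyY : y ∈ Y := ⟨hxy, hy.2⟩
  have hXY : Disjoint X Y := Set.disjoint_left.2 fun v hv hv' => hv'.1 hv
  have hno : ∀ v ∈ X, ∀ w ∈ Y, ¬ Γ.Adj v w := fun v hv w hw h =>
    hw.1 (mem_component_of_adj hv ⟨trivial, hw.2⟩ h)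
  have hout : ∀ v, v ∉ X ∪ Y → q (PresentedGroup.of v) = 1 := by
    intro v hv
    by_contra hne
    have hvS : v ∉ S := fun h => hne (hdead v h)
    exact hv (by_contra fun h => hv (Or.inr ⟨fun h' => hv (Or.inl h'), hvS⟩))
  obtain ⟨v, hv⟩ : ∃ v, q (PresentedGroup.of v) ≠ 1 := by
    by_contra hcon
    push Not at hcon
    exact hq (PresentedGroup.ext fun v => hcon v)
  by_cases hvX : v ∈ X
  · exact isWild_ker_of_disjoint hXY hno hout hvX hyY hv
  · have hvS : v ∉ S := fun h => hv (hdead v h)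
    exact isWild_ker_of_disjoint hXY.symm (fun v hv w hw h => hno w hw v hv h.symm)
      (fun v hv => hout v (by rwa [Set.union_comm])) ⟨hvX, hvS⟩ hxX hv

end Wild

section FinitelyGenerated

theorem not_fg_freeGroup_nat : ¬ Group.FG (FreeGroup ℕ) := by
  intro h
  let φ : FreeGroup ℕ →* Multiplicative (ℕ →₀ ℤ) :=
    FreeGroup.lift fun n => Multiplicative.ofAdd (Finsupp.single n 1)
  have hφ : Function.Surjective φ := by
    intro x
    induction x using Multiplicative.rec with
    | ofAdd x =>
    induction x using Finsupp.induction_linear with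
    | zero => exact ⟨1, map_one _⟩
    | add x y hx hy =>
      obtain ⟨a, ha⟩ := hx
      obtain ⟨b, hb⟩ := hy
      exact ⟨a * b, by rw [map_mul, ha, hb, ofAdd_add]⟩
    | single n k =>
      refine ⟨FreeGroup.of n ^ k, ?_⟩
      rw [map_zpow, FreeGroup.lift_apply_of, ← ofAdd_zsmul, Finsupp.smul_single, smul_eq_mul, mul_one]
  have h1 : Group.FG (Multiplicative (ℕ →₀ ℤ)) := Group.fg_of_surjective hφ
  have h2 : AddGroup.FG (ℕ →₀ ℤ) := AddGroup.fg_iff_mul_fg.2 h1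
  have h3 : Module.Finite ℤ (ℕ →₀ ℤ) := Module.Finite.iff_addGroup_fg.2 h2
  have := Module.Finite.finite_basis (Finsupp.basisSingleOne (R := ℤ) (ι := ℕ))
  exact not_finite ℕ

theorem IsFGFreeAbelian.fg {G : Type*} [Group G] (h : IsFGFreeAbelian G) : Group.FG G := by
  obtain ⟨n, ⟨e⟩⟩ := h
  have h1 : AddGroup.FG (Fin n → ℤ) := Module.Finite.iff_addGroup_fg.1 inferInstance
  have h2 : Group.FG (Multiplicative (Fin n → ℤ)) := AddGroup.fg_iff_mul_fg.1 h1
  exact Group.fg_of_surjective (f := e.symm.toMonoidHom) e.symm.surjective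

theorem GraphOfGroups.fg_fundamentalGroup (𝒢 : GraphOfGroups.{u}) (T : Set 𝒢.Edge)
    [Finite 𝒢.Vert] [Finite 𝒢.Edge] (h : ∀ v, Group.FG (𝒢.VGroup v)) :
    Group.FG (𝒢.FundamentalGroup T) := by
  choose S hS hSf using fun v => Group.fg_iff.1 (h v)
  let S' : Set (𝒢.FundamentalGroup T) :=
    (⋃ v, 𝒢.vertHom T v '' S v) ∪ Set.range (𝒢.edgeElt T)
  refine Group.fg_iff.2 ⟨S', ?_, ?_⟩
  · have hv : ∀ v a, 𝒢.vertHom T v a ∈ Subgroup.closure S' := by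
      intro v a
      have h1 : (Subgroup.closure (S v)).map (𝒢.vertHom T v) ≤ Subgroup.closure S' := by
        rw [MonoidHom.map_closure]
        exact Subgroup.closure_mono
          ((Set.subset_iUnion (fun v => 𝒢.vertHom T v '' S v) v).trans Set.subset_union_left)
      rw [hS v] at h1
      exact h1 ⟨a, trivial, rfl⟩
    have he : ∀ e, 𝒢.edgeElt T e ∈ Subgroup.closure S' := fun e =>
      Subgroup.subset_closure (Or.inr ⟨e, rfl⟩)
    obtain ⟨Φ, hΦv, hΦe⟩ := FundamentalGroup.exists_hom (𝒢 := 𝒢) (T := T)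
      (H := Subgroup.closure S') (fun v => (𝒢.vertHom T v).codRestrict _ (hv v))
      (fun e => ⟨_, he e⟩) (fun e a => Subtype.ext (𝒢.edgeElt_mul T e a))
      (fun e he => Subtype.ext (𝒢.edgeElt_of_mem T he))
    have hid : (Subgroup.subtype _).comp Φ = MonoidHom.id _ := by
      refine FundamentalGroup.hom_ext (fun v a => ?_) (fun e => ?_)
      · exact congrArg Subtype.val (hΦv v a)
      · exact congrArg Subtype.val (hΦe e)
    rw [eq_top_iff]
    intro x _
    have : ((Φ x : Subgroup.closure S') : 𝒢.FundamentalGroup T) = x := DFunLike.congr_fun hid x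
    rw [← this]
    exact (Φ x).2
  · exact (Set.finite_iUnion fun v => (hSf v).image _).union (Set.finite_range _)

theorem IsVGBS.not_isWild {G : Type u} [Group G] (h : IsVGBS G) : ¬ IsWild G := by
  rintro ⟨φ, hφ⟩
  obtain ⟨𝒢, ⟨hV, hE, hvg, -⟩, T, -, ⟨e⟩⟩ := h
  have := 𝒢.fg_fundamentalGroup T fun v => (hvg v).fg
  have hG : Group.FG G := Group.fg_of_surjective (f := e.symm.toMonoidHom) e.symm.surjective
  exact not_fg_freeGroup_nat (Group.fg_of_surjective hφ)

end FinitelyGenerated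

/-! ### Decompositions along clique separators -/

section Decomposition

variable {V : Type u} {Γ : SimpleGraph V}

/-- Iterated splittings are carried along embeddings of graphs of groups. -/
theorem IsIteratedCliqueSplitting.image {f : RAAG Γ →* Multiplicative ℝ}
    {𝒢 𝒢' : GraphOfGroups.{u}} {a : 𝒢.Vert → 𝒢'.Vert} (ha : Function.Injective a)
    {b : 𝒢.Edge → 𝒢'.Edge} (hb : Function.Injective b)
    (hsrc : ∀ e, 𝒢'.src (b e) = a (𝒢.src e)) (htgt : ∀ e, 𝒢'.tgt (b e) = a (𝒢.tgt e))
    (hv : ∀ v, Nonempty (𝒢'.VGroup (a v) ≃* 𝒢.VGroup v))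
    (he : ∀ e, Nonempty (𝒢'.EGroup (b e) ≃* 𝒢.EGroup e)) {C : Set V} {P : Set 𝒢.Vert}
    {R : Set 𝒢.Edge} (h : IsIteratedCliqueSplitting f 𝒢 C P R) :
    IsIteratedCliqueSplitting f 𝒢' C (a '' P) (b '' R) := by
  induction h with
  | clique C P hclique hindex hcard hgroup =>
    rw [Set.image_empty]
    refine .clique C _ hclique hindex ?_ ?_
    · rw [Set.ncard_image_of_injective _ ha, hcard]
    · rintro _ ⟨v, hvP, rfl⟩
      obtain ⟨e₁⟩ := hv v
      obtain ⟨e₂⟩ := hgroup v hvP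
      exact ⟨e₁.trans e₂⟩
  | split C A B PA PB QA QB R hsplit hminimal hclique _ _ hP hQ hQA hQB hindex hcard hgroup hends
      ihA ihB =>
    rw [Set.image_union, Set.image_union, Set.image_union]
    refine .split C A B _ _ _ _ _ hsplit hminimal hclique ihA ihB
      ((Set.disjoint_image_iff ha).2 hP) ((Set.disjoint_image_iff hb).2 hQ)
      ((Set.disjoint_image_iff hb).2 hQA) ((Set.disjoint_image_iff hb).2 hQB) hindex ?_ ?_ ?_
    · rw [Set.ncard_image_of_injective _ hb, hcard]
    · rintro _ ⟨e, heR, rfl⟩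
      obtain ⟨e₁⟩ := he e
      obtain ⟨e₂⟩ := hgroup e heR
      exact ⟨e₁.trans e₂⟩
    · rintro _ ⟨e, heR, rfl⟩
      rw [hsrc, htgt]
      exact ⟨⟨_, (hends e heR).1, rfl⟩, ⟨_, (hends e heR).2, rfl⟩⟩

/-- A graph of subgroups `D` that decomposes the full subgraph on `C` into cliques: its vertex groups
are generated by cliques, and it has the properties that carry through the induction over splittings
and, for `C = Set.univ`, imply that the covering graph of groups is as required. The field `exists_le`
provides the ends of new edges: a clique separator lies in some piece on either side. -/
structure IsCliqueDecomposition {Q : Type u} [CommGroup Q] (f : RAAG Γ →* Multiplicative ℝ)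
    (q : RAAG Γ →* Q) (C : Set V) (D : SubgroupGraph (RAAG Γ)) : Prop where
  finite_I : Finite D.I
  finite_J : Finite D.J
  nonempty : Nonempty D.I
  index_U : ∀ i, ((D.U i).map q).index ≠ 0
  index_S : ∀ j, ((D.S j).map q).index ≠ 0
  exists_clique : ∀ i, ∃ K : Set V, Γ.IsClique K ∧ D.U i = vertexSubgroup Γ K
  exists_le : ∀ K ⊆ C, Γ.IsClique K → ∃ i, vertexSubgroup Γ K ≤ D.U i
  isConnected : D.IsConnected
  iSup_eq : ⨆ i, D.U i = vertexSubgroup Γ C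
  hasExtension : D.HasExtension q (vertexSubgroup Γ C)
  isIterated : IsIteratedCliqueSplitting f (D.cover q) C Set.univ Set.univ

variable {Q : Type u} [CommGroup Q] {f : RAAG Γ →* Multiplicative ℝ} {q : RAAG Γ →* Q}

theorem isCliqueDecomposition_single (hq : Function.Surjective q) (hker : q.ker = f.ker)
    {C : Set V} (hC : Γ.IsClique C) (hindex : ((vertexSubgroup Γ C).map q).index ≠ 0) :
    IsCliqueDecomposition f q C (.single (vertexSubgroup Γ C) (vertexSubgroup_comm hC)) where
  finite_I := inferInstanceAs (Finite PUnit)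
  finite_J := inferInstanceAs (Finite PEmpty)
  nonempty := ⟨PUnit.unit⟩
  index_U _ := hindex
  index_S j := j.elim
  exists_clique _ := ⟨C, hC, rfl⟩
  exists_le K hK _ := ⟨PUnit.unit, vertexSubgroup_mono hK⟩
  isConnected := by
    rintro ⟨⟩ ⟨⟩
    exact .refl _
  iSup_eq := iSup_const (ι := PUnit)
  hasExtension := SubgroupGraph.hasExtension_single q _ _
  isIterated := by
    have hempty : (Set.univ : Set ((SubgroupGraph.single (vertexSubgroup Γ C)
        (vertexSubgroup_comm hC)).cover q).Edge) = ∅ := by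
      ext e
      exact e.1.elim
    rw [hempty]
    have hidx := imageIndex_eq f q hq hker C
    refine .clique C _ hC (hidx ▸ hindex) ?_ ?_
    · rw [Set.ncard_univ, hidx, Subgroup.index]
      exact Nat.card_congr (Equiv.uniqueSigma (fun _ : PUnit => Q ⧸ (vertexSubgroup Γ C).map q))
    · rintro v -
      obtain ⟨e⟩ := nonempty_ker_restrict_equiv f C
      exact ⟨(MulEquiv.subgroupCongr (show vertexSubgroup Γ C ⊓ q.ker = _ by rw [hker])).trans e⟩

theorem isCliqueDecomposition_join (hq : Function.Surjective q) (hker : q.ker = f.ker)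
    {C A B : Set V} (hsplit : IsSplitting Γ C A B)
    (hmin : Minimal (IsSeparating Γ C) (A ∩ B)) (hclique : Γ.IsClique (A ∩ B))
    (hindex : ((vertexSubgroup Γ (A ∩ B)).map q).index ≠ 0) {D₁ D₂ : SubgroupGraph (RAAG Γ)}
    (h₁ : IsCliqueDecomposition f q A D₁) (h₂ : IsCliqueDecomposition f q B D₂) :
    ∃ D, IsCliqueDecomposition f q C D := by
  obtain ⟨i₁, hi₁⟩ := h₁.exists_le _ Set.inter_subset_left hclique
  obtain ⟨i₂, hi₂⟩ := h₂.exists_le _ Set.inter_subset_right hclique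
  have hU₁ : ∀ i, D₁.U i ≤ vertexSubgroup Γ A := fun i => h₁.iSup_eq ▸ le_iSup D₁.U i
  have hU₂ : ∀ i, D₂.U i ≤ vertexSubgroup Γ B := fun i => h₂.iSup_eq ▸ le_iSup D₂.U i
  have hC : A ∪ B = C := hsplit.1
  let D := SubgroupGraph.join D₁ D₂ (vertexSubgroup Γ (A ∩ B)) i₁ i₂ hi₁ hi₂
  have := h₁.finite_I
  have := h₁.finite_J
  have := h₂.finite_I
  have := h₂.finite_J
  refine ⟨D, ?_⟩
  refine
    { finite_I := inferInstanceAs (Finite (D₁.I ⊕ D₂.I))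
      finite_J := inferInstanceAs (Finite ((D₁.J ⊕ D₂.J) ⊕ PUnit))
      nonempty := ⟨Sum.inl i₁⟩
      index_U := ?_
      index_S := ?_
      exists_clique := ?_
      exists_le := ?_
      isConnected := ?_
      iSup_eq := ?_
      hasExtension := ?_
      isIterated := ?_ }
  · rintro (i | i)
    exacts [h₁.index_U i, h₂.index_U i]
  · rintro ((j | j) | j)
    exacts [h₁.index_S j, h₂.index_S j, hindex]
  · rintro (i | i)
    exacts [h₁.exists_clique i, h₂.exists_clique i]
  · intro K hK hKc
    rcases hsplit.subset_or_subset hKc hK with h | h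
    · obtain ⟨i, hi⟩ := h₁.exists_le K h hKc
      exact ⟨Sum.inl i, hi⟩
    · obtain ⟨i, hi⟩ := h₂.exists_le K h hKc
      exact ⟨Sum.inr i, hi⟩
  · have hl : ∀ i i', Relation.EqvGen (fun a b => ∃ j, D.src j = a ∧ D.tgt j = b)
        (Sum.inl i) (Sum.inl i') := by
      intro i i'
      induction h₁.isConnected i i' with
      | rel i i' h =>
        obtain ⟨j, rfl, rfl⟩ := h
        exact .rel _ _ ⟨Sum.inl (Sum.inl j), rfl, rfl⟩
      | refl => exact .refl _
      | symm _ _ _ ih => exact .symm _ _ ih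
      | trans _ _ _ _ _ ih ih' => exact .trans _ _ _ ih ih'
    have hr : ∀ i i', Relation.EqvGen (fun a b => ∃ j, D.src j = a ∧ D.tgt j = b)
        (Sum.inr i) (Sum.inr i') := by
      intro i i'
      induction h₂.isConnected i i' with
      | rel i i' h =>
        obtain ⟨j, rfl, rfl⟩ := h
        exact .rel _ _ ⟨Sum.inl (Sum.inr j), rfl, rfl⟩
      | refl => exact .refl _
      | symm _ _ _ ih => exact .symm _ _ ih
      | trans _ _ _ _ _ ih ih' => exact .trans _ _ _ ih ih'
    have hlr : ∀ i i', Relation.EqvGen (fun a b => ∃ j, D.src j = a ∧ D.tgt j = b)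
        (Sum.inl i) (Sum.inr i') := fun i i' =>
      .trans _ _ _ (hl i i₁) (.trans _ _ _ (.rel _ _ ⟨Sum.inr PUnit.unit, rfl, rfl⟩) (hr i₂ i'))
    rintro (i | i) (i' | i')
    exacts [hl i i', hlr i i', .symm _ _ (hlr i' i), hr i i']
  · change ⨆ i : D₁.I ⊕ D₂.I, Sum.elim D₁.U D₂.U i = _
    rw [iSup_sum, ← hC, vertexSubgroup_union, ← h₁.iSup_eq, ← h₂.iSup_eq]
    rfl
  · refine SubgroupGraph.hasExtension_join q hi₁ hi₂ hU₁ hU₂ h₁.hasExtension h₂.hasExtension ?_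
    rw [← hC]
    exact hasGluing_vertexSubgroup q (by rw [hC]; exact hsplit.2.2.2.2.2)
  · let a₁ : (D₁.cover q).Vert → (D.cover q).Vert := fun v => ⟨Sum.inl v.1, v.2⟩
    let a₂ : (D₂.cover q).Vert → (D.cover q).Vert := fun v => ⟨Sum.inr v.1, v.2⟩
    let b₁ : (D₁.cover q).Edge → (D.cover q).Edge := fun e => ⟨Sum.inl (Sum.inl e.1), e.2⟩
    let b₂ : (D₂.cover q).Edge → (D.cover q).Edge := fun e => ⟨Sum.inl (Sum.inr e.1), e.2⟩
    let b₃ : Q ⧸ (vertexSubgroup Γ (A ∩ B)).map q → (D.cover q).Edge :=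
      fun d => ⟨Sum.inr PUnit.unit, d⟩
    have ha₁ : Function.Injective a₁ := by
      rintro ⟨i, c⟩ ⟨i', c'⟩ h
      cases h
      rfl
    have ha₂ : Function.Injective a₂ := by
      rintro ⟨i, c⟩ ⟨i', c'⟩ h
      cases h
      rfl
    have hb₁ : Function.Injective b₁ := by
      rintro ⟨i, c⟩ ⟨i', c'⟩ h
      cases h
      rfl
    have hb₂ : Function.Injective b₂ := by
      rintro ⟨i, c⟩ ⟨i', c'⟩ h
      cases h
      rfl
    have hb₃ : Function.Injective b₃ := by
      intro c c' h
      cases h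
      rfl
    have hidx := imageIndex_eq f q hq hker (A ∩ B)
    have hV : (Set.univ : Set (D.cover q).Vert) = a₁ '' Set.univ ∪ a₂ '' Set.univ := by
      symm
      rw [Set.eq_univ_iff_forall]
      rintro ⟨i | i, c⟩
      exacts [Or.inl ⟨⟨i, c⟩, trivial, rfl⟩, Or.inr ⟨⟨i, c⟩, trivial, rfl⟩]
    have hE : (Set.univ : Set (D.cover q).Edge) =
        b₁ '' Set.univ ∪ b₂ '' Set.univ ∪ Set.range b₃ := by
      symm
      rw [Set.eq_univ_iff_forall]
      rintro ⟨(j | j) | j, d⟩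
      exacts [Or.inl (Or.inl ⟨⟨j, d⟩, trivial, rfl⟩), Or.inl (Or.inr ⟨⟨j, d⟩, trivial, rfl⟩),
        Or.inr ⟨d, rfl⟩]
    rw [hV, hE]
    refine .split C A B _ _ _ _ _ hsplit hmin hclique
      (h₁.isIterated.image ha₁ hb₁ (fun _ => rfl) (fun _ => rfl) (fun _ => ⟨MulEquiv.refl _⟩)
        (fun _ => ⟨MulEquiv.refl _⟩))
      (h₂.isIterated.image ha₂ hb₂ (fun _ => rfl) (fun _ => rfl) (fun _ => ⟨MulEquiv.refl _⟩)
        (fun _ => ⟨MulEquiv.refl _⟩)) ?_ ?_ ?_ ?_ (hidx ▸ hindex) ?_ ?_ ?_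
    · rw [Set.disjoint_left]
      rintro _ ⟨v, -, rfl⟩ ⟨w, -, h⟩
      cases h
    · rw [Set.disjoint_left]
      rintro _ ⟨v, -, rfl⟩ ⟨w, -, h⟩
      cases h
    · rw [Set.disjoint_left]
      rintro _ ⟨v, rfl⟩ ⟨w, -, h⟩
      cases h
    · rw [Set.disjoint_left]
      rintro _ ⟨v, rfl⟩ ⟨w, -, h⟩
      cases h
    · rw [← Set.image_univ, Set.ncard_image_of_injective _ hb₃, Set.ncard_univ, hidx]
      rfl
    · rintro _ ⟨d, rfl⟩
      obtain ⟨e⟩ := nonempty_ker_restrict_equiv f (A ∩ B)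
      exact ⟨(MulEquiv.subgroupCongr
        (show vertexSubgroup Γ (A ∩ B) ⊓ q.ker = _ by rw [hker])).trans e⟩
    · rintro _ ⟨d, rfl⟩
      exact ⟨⟨⟨i₁, ((d.out : Q) : Q ⧸ (D₁.U i₁).map q)⟩, trivial, rfl⟩,
        ⟨⟨i₂, ((d.out : Q) : Q ⧸ (D₂.U i₂).map q)⟩, trivial, rfl⟩⟩

/-- Split along a minimal separator, which is a clique by Dirac's theorem and nonempty because `q` is
nontrivial on it. Separators of the two pieces separate `C`, so the hypotheses are inherited. -/
theorem exists_isCliqueDecomposition [Finite V] (hΓ : IsChordal Γ) (hq : Function.Surjective q)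
    (hker : q.ker = f.ker)
    (hindex : ∀ g, q g ≠ 1 → ∀ M : Subgroup Q, q g ∈ M → M.index ≠ 0) (C : Set V)
    (hC : ∃ v ∈ C, q (PresentedGroup.of v) ≠ 1)
    (hS : ∀ S, IsSeparating Γ C S → ∃ v ∈ S, q (PresentedGroup.of v) ≠ 1) :
    ∃ D, IsCliqueDecomposition f q C D := by
  have hindex' : ∀ C : Set V, (∃ v ∈ C, q (PresentedGroup.of v) ≠ 1) →
      ((vertexSubgroup Γ C).map q).index ≠ 0 := by
    rintro C ⟨v, hv, hqv⟩
    exact hindex _ hqv _ ⟨_, of_mem_vertexSubgroup hv, rfl⟩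
  induction C using WellFoundedLT.induction with
  | ind C ih =>
  by_cases hclique : Γ.IsClique C
  · exact ⟨_, isCliqueDecomposition_single hq hker hclique (hindex' C hC)⟩
  · obtain ⟨S, hmin⟩ := exists_minimal_isSeparating hclique
    have hSc := isClique_of_minimal_isSeparating hΓ hmin
    have hSl := hS S hmin.prop
    obtain ⟨v, hvS, hv⟩ := hSl
    obtain ⟨A, B, rfl, hsplit, hA, hB⟩ := exists_isSplitting hmin.prop ⟨v, hvS⟩
    obtain ⟨D₁, h₁⟩ := ih A hA ⟨v, hvS.1, hv⟩ fun S' hS' => hS S' (hS'.of_isSplitting hsplit hSc)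
    obtain ⟨D₂, h₂⟩ := ih B hB ⟨v, hvS.2, hv⟩ fun S' hS' =>
      hS S' (hS'.of_isSplitting hsplit.symm (by rwa [Set.inter_comm]))
    exact isCliqueDecomposition_join hq hker hsplit hmin hSc (hindex' _ ⟨v, hvS, hv⟩) h₁ h₂

theorem IsCliqueDecomposition.isFiniteFreeAbelian [Finite V] {C : Set V}
    {D : SubgroupGraph (RAAG Γ)} (h : IsCliqueDecomposition f q C D) :
    IsFiniteFreeAbelian (D.cover q) := by
  have := h.finite_I
  have := h.finite_J
  have hfin : ∀ M : Subgroup Q, M.index ≠ 0 → Finite (Q ⧸ M) := fun M hM => by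
    have : M.FiniteIndex := ⟨hM⟩
    infer_instance
  have hfab : ∀ i, ∀ K : Subgroup (RAAG Γ), K ≤ D.U i → IsFGFreeAbelian K := by
    intro i K hK
    obtain ⟨C, hC, hU⟩ := h.exists_clique i
    exact isFGFreeAbelian_of_le hC (hU ▸ hK)
  refine ⟨?_, ?_, fun v => hfab v.1 _ inf_le_left,
    fun e => hfab (D.src e.1) _ (inf_le_left.trans (D.src_le e.1))⟩
  · have := fun i => hfin _ (h.index_U i)
    exact inferInstanceAs (Finite (Σ i, Q ⧸ (D.U i).map q))
  · have := fun j => hfin _ (h.index_S j)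
    exact inferInstanceAs (Finite (Σ j, Q ⧸ (D.S j).map q))

end Decomposition

/-! ### The dichotomy -/

theorem index_ne_zero_of_mem {Q : Type*} [Group Q] (e : Q ≃* Multiplicative ℤ) {g : Q}
    (hg : g ≠ 1) {M : Subgroup Q} (hM : g ∈ M) : M.index ≠ 0 := by
  rw [← M.index_map_equiv e]
  have hk : (e g).toAdd ≠ 0 := fun h => hg (e.map_eq_one_iff.1 (toAdd_eq_zero.1 h))
  have hle : AddSubgroup.toSubgroup (AddSubgroup.zmultiples (e g).toAdd) ≤
      M.map (e : Q →* Multiplicative ℤ) := by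
    rintro _ ⟨k, rfl⟩
    refine ⟨g ^ k, M.zpow_mem hM k, (map_zpow e g k).trans ?_⟩
    apply Multiplicative.toAdd.injective
    rw [toAdd_zpow]
    rfl
  refine ne_zero_of_dvd_ne_zero ?_ (Subgroup.index_dvd_of_le hle)
  rw [AddSubgroup.index_toSubgroup, Int.index_zmultiples]
  exact Int.natAbs_ne_zero.2 hk

/-- The kernel is wild if `f` is trivial on some separating set, the empty set included, and otherwise
`Γ` decomposes along minimal separators, on all of which `f` is nontrivial. -/
theorem isWild_or_exists_splitting {V : Type u} [Finite V] {Γ : SimpleGraph V}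
    (hΓ : IsChordal Γ) {f : RAAG Γ →* Multiplicative ℝ} (hf : IsDiscreteCharacter f) :
    IsWild f.ker ∨ ∃ 𝒢 : GraphOfGroups.{u}, IsFiniteFreeAbelian 𝒢 ∧ SplitsAs f.ker 𝒢 ∧
      IsIteratedCliqueSplitting f 𝒢 Set.univ Set.univ Set.univ := by
  obtain ⟨hcyc, hinf⟩ := hf
  let e : f.range ≃* Multiplicative ℤ := (intCyclicMulEquiv (G := f.range)).symm
  let q₀ : RAAG Γ →* Multiplicative ℤ := e.toMonoidHom.comp f.rangeRestrict
  have hq₀ : Function.Surjective q₀ := e.surjective.comp f.rangeRestrict_surjective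
  have hker₀ : q₀.ker = f.ker := 
    (MonoidHom.ker_mulEquiv_comp _ e).trans f.ker_rangeRestrict
  by_cases hS : ∃ S, IsSeparating Γ Set.univ S ∧ ∀ v ∈ S, q₀ (PresentedGroup.of v) = 1
  · left
    obtain ⟨S, hS, hdead⟩ := hS
    rw [← hker₀]
    refine isWild_ker_of_isSeparating (fun h => ?_) hS hdead
    obtain ⟨g, hg⟩ := hq₀ (Multiplicative.ofAdd 1)
    rw [h] at hg
    exact absurd (congrArg Multiplicative.toAdd hg) zero_ne_one
  · right
    push Not at hS
    let e' : ULift.{u} (Multiplicative ℤ) ≃* Multiplicative ℤ := MulEquiv.ulift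
    let q : RAAG Γ →* ULift.{u} (Multiplicative ℤ) := e'.symm.toMonoidHom.comp q₀
    have hq : Function.Surjective q := e'.symm.surjective.comp hq₀
    have hker : q.ker = f.ker := (MonoidHom.ker_mulEquiv_comp _ e'.symm).trans hker₀
    have hq1 : ∀ g, q g = 1 ↔ q₀ g = 1 := fun g => e'.symm.map_eq_one_iff
    obtain ⟨D, hD⟩ := exists_isCliqueDecomposition (q := q) hΓ hq hker
      (fun g hg M hM => index_ne_zero_of_mem e' hg hM) Set.univ (by
        by_contra hcon
        push Not at hcon
        have : q₀ = 1 := PresentedGroup.ext fun v => (hq1 _).1 (hcon v trivial)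
        obtain ⟨g, hg⟩ := hq₀ (Multiplicative.ofAdd 1)
        rw [this] at hg
        exact absurd (congrArg Multiplicative.toAdd hg) zero_ne_one)
      (fun S h => by
        obtain ⟨v, hv, hqv⟩ := hS S h
        exact ⟨v, hv, fun h => hqv ((hq1 _).1 h)⟩)
    have := hD.nonempty
    have hsplit := SubgroupGraph.splitsAs_cover hq hD.isConnected
      (hD.iSup_eq.trans vertexSubgroup_univ) (vertexSubgroup_univ (Γ := Γ) ▸ hD.hasExtension)
    rw [hker] at hsplit
    exact ⟨_, hD.isFiniteFreeAbelian, hsplit, hD.isIterated⟩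

end ArtinKernel

theorem theorem3p8 {V : Type*} [Finite V] (Γ : SimpleGraph V) (hΓ : ArtinKernel.IsChordal Γ)
    (f : ArtinKernel.RAAG Γ →* Multiplicative ℝ) (hf : ArtinKernel.IsDiscreteCharacter f) :
    Xor (ArtinKernel.IsWild f.ker) (ArtinKernel.IsVGBS f.ker) ∧
    (ArtinKernel.IsVGBS f.ker →
      ∃ 𝒢 : ArtinKernel.GraphOfGroups,
        ArtinKernel.IsFiniteFreeAbelian 𝒢 ∧ ArtinKernel.SplitsAs f.ker 𝒢 ∧
        ArtinKernel.IsIteratedCliqueSplitting f 𝒢 Set.univ Set.univ Set.univ) := by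
  rcases ArtinKernel.isWild_or_exists_splitting hΓ hf with hw | ⟨𝒢, h𝒢, hsplit, hiter⟩
  · have hn : ¬ ArtinKernel.IsVGBS f.ker := fun h => h.not_isWild hw
    exact ⟨Or.inl ⟨hw, hn⟩, fun h => absurd h hn⟩
  · have hv : ArtinKernel.IsVGBS f.ker := ⟨𝒢, h𝒢, hsplit⟩
    exact ⟨Or.inr ⟨hv, hv.not_isWild⟩, fun _ => ⟨𝒢, h𝒢, hsplit, hiter⟩⟩
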